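/- Let $\Lambda=\mathbb{C}[p_r;\ r\ge 1]$ be the ring of symmetric functions in $x=(x_1,x_2,\dots)$, where $p_r=p_r(x)$ is the $r$-th power sum, and let $\langle\ ,\ \rangle_0$ be the inner product on $\Lambda$ (linear in the first, conjugate linear in the second argument) with $\langle p_\rho,p_\sigma\rangle_0=z_\rho\,\delta_{\rho\sigma}$ for all partitions $\rho,\sigma$, where $z_\rho=\prod_{i\ge1} i^{m_i}m_i!$ for $\rho=(1^{m_1}2^{m_2}\cdots)$. For a partition $\nu$ let $S_\nu(x)$ be the Schur function. For a strict partition $\mu$ let $Q_\mu(x)$ be Schur's $Q$-function and $P_\mu(x)=2^{-\ell(\mu)}Q_\mu(x)$ Schur's $P$-function. Write $S_\nu(x,x)$ for the image of $S_\nu(x)$ under $p_r\mapsto 2p_r$, and $S_\nu(x^2)$ for its image under $p_r\mapsto p_{2r}$. For a partition $\lambda$, with multiplicities $m_i(\lambda)$, let $\lambda^r$ be the strict partition with $m_i(\lambda^r)\in\{0,1\}$, $m_i(\lambda^r)\equiv m_i(\lambda)\pmod 2$, and $\lambda^d$ the partition with $m_i(\lambda^d)=\lfloor m_i(\lambda)/2\rfloor$,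 for all $i\ge 1$. Put $W_\lambda(x)=Q_{\lambda^r}(x)\,S_{\lambda^d}(x^2)$. Proposition 4.9. Let $n\ge 0$ and let $P_n$ be the set of partitions of $n$. There is exactly one complex matrix $A_n=(a_{\lambda\mu})_{\lambda,\mu\in P_n}$ such that $$S_\lambda(x,x)=\sum_{\mu\in P_n}a_{\lambda\mu}W_\mu(x)\qquad\text{for all }\lambda\in P_n,$$ and it satisfies $${}^tA_nA_n=\Big(\langle P_{\lambda^r}(x),P_{\mu^r}(x)\rangle_0\;\langle S_{\lambda^d}(x^2),S_{\mu^d}(x^2)\rangle_0\Big)_{\lambda,\mu\in P_n}.$$ -/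

import Mathlib

open MvPolynomial
open scoped Nat ComplexConjugate

noncomputable section

namespace CompoundBasis

/-- The ring `Λ = ℂ[p₁, p₂, p₃, …]` of symmetric functions in an infinite alphabet
`x = (x₁, x₂, …)`; the variable `X r` is the power sum `p_r(x)`. Thus the monomial with exponent
vector `m` is `p_ρ`, where `ρ = (1^{m₁} 2^{m₂} ⋯)`. -/
abbrev Sym : Type := MvPolynomial ℕ+ ℂ

/-- `z_ρ = ∏ r ^ {m_r} m_r!` for `ρ = (1^{m₁} 2^{m₂} ⋯)`, given by its multiplicities. -/
def zee (m : ℕ+ →₀ ℕ) : ℂ := m.prod fun r k => (r : ℂ) ^ k * (k ! : ℂ)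

/-- The inner product `⟨ , ⟩₀`: linear in the first and conjugate linear in the second argument,
with `⟨p_ρ, p_σ⟩₀ = z_ρ δ_{ρσ}`. -/
def inner₀ (F G : Sym) : ℂ :=
  ∑ m ∈ F.support, F.coeff m * conj (G.coeff m) * zee m

/-- The multiplicities `(m₁, m₂, …)` of a partition `ρ = (1^{m₁} 2^{m₂} ⋯)`. -/
def mults {n : ℕ} (ρ : n.Partition) : ℕ+ →₀ ℕ := Multiset.toFinsupp (ρ.parts.map Nat.toPNat')

/-- The complete symmetric function `h_n = ∑_{ρ ⊢ n} z_ρ⁻¹ p_ρ`. -/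
def h (n : ℕ) : Sym := ∑ ρ : n.Partition, monomial (mults ρ) (zee (mults ρ))⁻¹

/-- `h_k` for an integer index, with `h_k = 0` for `k < 0`. -/
def hInt (k : ℤ) : Sym := if 0 ≤ k then h k.toNat else 0

/-- `q_n = ∑ 2 ^ ℓ(ρ) z_ρ⁻¹ p_ρ`, the sum over the partitions `ρ` of `n` into odd parts;
equivalently `∑ q_n zⁿ = ∏ (1 + x_i z) / (1 - x_i z)`. -/
def q (n : ℕ) : Sym :=
  ∑ ρ ∈ Nat.Partition.odds n, monomial (mults ρ) (2 ^ Multiset.card ρ.parts * (zee (mults ρ))⁻¹)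

/-- The Schur function `S_ν = det (h_{ν_i - i + j})` of a partition `ν`, given as the multiset of
its (positive) parts. -/
def schur (ν : Multiset ℕ) : Sym :=
  Matrix.det (Matrix.of fun i j : Fin (ν.sort (· ≥ ·)).length =>
    hInt (((ν.sort (· ≥ ·)).get i : ℤ) - (i : ℤ) + (j : ℤ)))

/-- The Pfaffian of an alternating matrix of size `2 m`, by expansion along the first row:
`Pf A = ∑_{j ≥ 2} (-1)^j a_{1j} Pf A_{1j}`, where `A_{1j}` is `A` without the rows and columns
`1` and `j`. -/
def pfaffian {R : Type*} [CommRing R] : (m : ℕ) → Matrix (Fin (2 * m)) (Fin (2 * m)) R → R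
  | 0, _ => 1
  | m + 1, A => ∑ j : Fin (2 * m + 1), (-1) ^ (j : ℕ) * A 0 j.succ *
      pfaffian m (A.submatrix (fun a => (j.succAbove a).succ) (fun a => (j.succAbove a).succ))

/-- `Q_{(r,s)} = q_r q_s + 2 ∑_{i=1}^{s} (-1)^i q_{r+i} q_{s-i}`, and `Q_{(r,r)} = 0`. -/
def qTwo (r s : ℕ) : Sym :=
  if r = s then 0
  else q r * q s + 2 * ∑ i ∈ Finset.Icc 1 s, (-1) ^ i * (q (r + i) * q (s - i))

/-- Schur's `Q`-function `Q_λ = Pf (Q_{(λ_i, λ_j)})` of a strict partition `λ`, given as the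
multiset of its parts; `λ₁ > λ₂ > ⋯ > λ_{2m} ≥ 0`, a part `0` being added if the number of parts
is odd. -/
def schurQ (l : Multiset ℕ) : Sym :=
  pfaffian ((Multiset.card l + 1) / 2) (Matrix.of fun i j =>
    qTwo ((l.sort (· ≥ ·)).getD i 0) ((l.sort (· ≥ ·)).getD j 0))

/-- Schur's `P`-function `P_λ = 2 ^ {-ℓ(λ)} Q_λ` of a strict partition. -/
def schurP (l : Multiset ℕ) : Sym := C (((2 : ℂ) ^ Multiset.card l)⁻¹) * schurQ l

/-- The strict partition `λ^r`: its multiplicities are those of `λ` modulo `2`. -/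
def rPart {n : ℕ} (l : n.Partition) : Multiset ℕ :=
  Finsupp.toMultiset ((Multiset.toFinsupp l.parts).mapRange (· % 2) rfl)

/-- The partition `λ^d`: its multiplicities are the integer parts of halves of those of `λ`. -/
def dPart {n : ℕ} (l : n.Partition) : Multiset ℕ :=
  Finsupp.toMultiset ((Multiset.toFinsupp l.parts).mapRange (· / 2) rfl)

/-- `F(x) ↦ F(x, x)`, where `(x, x) = (x₁, x₁, x₂, x₂, …)`: `p_r ↦ 2 p_r`. -/
def doubled : Sym →ₐ[ℂ] Sym := aeval fun r : ℕ+ => 2 * X r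

/-- `F(x) ↦ F(x²)`, where `x² = (x₁², x₂², …)`: `p_r ↦ p_{2r}`. -/
def squared : Sym →ₐ[ℂ] Sym := aeval fun r : ℕ+ => X (2 * r)

/-- The compound function `W_λ(x) = Q_{λ^r}(x) S_{λ^d}(x²)`. -/
def W {n : ℕ} (l : n.Partition) : Sym := schurQ (rPart l) * squared (schur (dPart l))

/-- `A = A_n` is the transition matrix from the compound basis to the Schur functions:
`S_λ(x, x) = ∑_{μ ⊢ n} a_{λμ} W_μ(x)` for all partitions `λ` of `n`. -/
def IsTransitionMatrix (n : ℕ) (A : Matrix n.Partition n.Partition ℂ) : Prop :=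
  ∀ l : n.Partition, doubled (schur l.parts) = ∑ m : n.Partition, C (A l m) * W m

end CompoundBasis

end

open MvPolynomial
open scoped Nat ComplexConjugate

noncomputable section

namespace CompoundBasis

/-! For weights `w`, let `form w` be the bilinear form in which the `p_ρ` are orthogonal and
multiplication by `p_r` is adjoint to `w_r ∂/∂p_r`. Weights `r` give the bilinear version of
`inner₀`; weights `r / 2` give a second form, for which F ↦ F(x, x) satisfies ⟨F(x, x), G⟩_{r/2} =
⟨F, G⟩_r (`form_doubled`). Put V_μ = P_{μ^r}(x) S_{μ^d}(x²). For the weights `r / 2` the families W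
and V are dual (`form_W_dualW`): Q_λ and P_λ are dual and involve only odd power sums, while S_ν(x²)
involves only even ones and remains orthonormal because p_{2r} has weight r. The form factors over
odd and even variables (`form_mul_mul`). Hence necessarily a_{λμ} = ⟨S_λ(x, x), V_μ⟩_{r/2} = ⟨S_λ,
V_μ⟩_r. As the S_λ are orthonormal for the weights `r`, the (λ, μ) entry of ᵗA A is ∑_ν ⟨S_ν,
V_λ⟩⟨S_ν, V_μ⟩ = ⟨V_λ, V_μ⟩_r, which factors again. Conjugation plays no role because all the
functions have real coefficients. The two orthogonality theorems come from vertex operators. Schur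
functions and Q-functions are obtained by applying operators B_m and Y_m successively to 1
(`det_expPart_hLog`, `pfaffian_qTwo`). The adjoints are operators of the same kind (`form_vertex`),
and the relations `eVertex_hVertex` and `qVertex_anticomm` move an adjoint to the right until it
annihilates 1. Generating-function identities are proved by `eq_zero_of_hasDegree`: a homogeneous
element of positive degree is zero once all its derivatives ∂/∂p_r are, so it suffices to compare
derivatives and settle degree 0. -/

/-! ### The grading, and vanishing by induction on the degree -/

/-- The degree of `p_r` is `r`. -/
abbrev degWeight : ℕ+ → ℤ := fun r => (r : ℤ)

/-- `F` is homogeneous of degree `d`, where `p_r` has degree `r`. -/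
abbrev HasDegree (F : Sym) (d : ℤ) : Prop := IsWeightedHomogeneous degWeight F d

theorem weight_toFinsupp_map_toPNat' (s : Multiset ℕ) (hs : ∀ i ∈ s, 0 < i) :
    Finsupp.weight degWeight (Multiset.toFinsupp (s.map Nat.toPNat')) = (s.sum : ℤ) := by
  induction s using Multiset.induction_on with
  | empty => simp
  | cons a s ih =>
    have ha : 0 < a := hs a (Multiset.mem_cons_self a s)
    rw [Multiset.map_cons, ← Multiset.singleton_add, map_add, map_add,
      ih fun i hi => hs i (Multiset.mem_cons_of_mem hi), Multiset.toFinsupp_singleton,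
      Finsupp.weight_single]
    simp [Nat.toPNat'_coe, ha]

theorem weight_mults {n : ℕ} (ρ : n.Partition) :
    Finsupp.weight degWeight (mults ρ) = n := by
  rw [mults, weight_toFinsupp_map_toPNat' _ fun i hi => ρ.parts_pos hi, ρ.parts_sum]

theorem map_coe_map_toPNat' (s : Multiset ℕ) (hs : ∀ i ∈ s, 0 < i) :
    (s.map Nat.toPNat').map ((↑) : ℕ+ → ℕ) = s := by
  rw [Multiset.map_map]
  conv_rhs => rw [← Multiset.map_id s]
  refine Multiset.map_congr rfl fun i hi => ?_
  simp [Nat.toPNat'_coe, hs i hi]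

theorem mults_injective (n : ℕ) : Function.Injective (mults : n.Partition → ℕ+ →₀ ℕ) := by
  intro ρ σ h
  have h' := Multiset.toFinsupp.injective h
  ext1
  rw [← map_coe_map_toPNat' ρ.parts fun i hi => ρ.parts_pos hi, h',
    map_coe_map_toPNat' σ.parts fun i hi => σ.parts_pos hi]

theorem weight_eq_sum_toMultiset (m : ℕ+ →₀ ℕ) :
    Finsupp.weight degWeight m = (((Finsupp.toMultiset m).map ((↑) : ℕ+ → ℕ)).sum : ℕ) := by
  induction m using Finsupp.induction with
  | zero => simp
  | single_add a b f _ _ ih =>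
    rw [map_add, ih, map_add, Finsupp.weight_single]
    simp [Multiset.map_nsmul, Multiset.sum_nsmul, degWeight]

theorem exists_mults_eq {n : ℕ} {m : ℕ+ →₀ ℕ} (hm : Finsupp.weight degWeight m = n) :
    ∃ ρ : n.Partition, mults ρ = m := by
  rw [weight_eq_sum_toMultiset, Nat.cast_inj] at hm
  refine ⟨⟨(Finsupp.toMultiset m).map ((↑) : ℕ+ → ℕ), ?_, hm⟩, ?_⟩
  · intro i hi
    obtain ⟨r, -, rfl⟩ := Multiset.mem_map.1 hi
    exact r.pos
  · simp only [mults, Multiset.map_map, Function.comp_def, PNat.coe_toPNat', Multiset.map_id']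
    exact Finsupp.toMultiset_toFinsupp m

theorem weight_nonneg (m : ℕ+ →₀ ℕ) : 0 ≤ Finsupp.weight degWeight m := by
  rw [weight_eq_sum_toMultiset]
  positivity

theorem eq_zero_of_weight_eq_zero {m : ℕ+ →₀ ℕ} (hm : Finsupp.weight degWeight m = 0) :
    m = 0 := by
  ext r
  by_contra h
  have h1 : (Finsupp.weight degWeight) (m - Finsupp.single r 1 + Finsupp.single r 1) = 0 := by
    rw [tsub_add_cancel_of_le, hm]
    simpa [Nat.one_le_iff_ne_zero] using h
  rw [map_add, Finsupp.weight_single] at h1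
  have h2 := weight_nonneg (m - Finsupp.single r 1)
  have h3 := r.pos
  simp only [one_smul, degWeight] at h1
  omega

theorem HasDegree.eq_zero_of_neg {F : Sym} {d : ℤ} (hF : HasDegree F d) (hd : d < 0) :
    F = 0 := by
  ext m
  by_contra h
  have := hF h
  have := weight_nonneg m
  omega

theorem HasDegree.eq_C {F : Sym} (hF : HasDegree F 0) : F = C (F.coeff 0) := by
  ext m
  rw [coeff_C]
  split_ifs with h
  · rw [h]
  · by_contra h'
    exact h (eq_zero_of_weight_eq_zero (hF h')).symm

/-- Characteristic zero: up to the nonzero factor `m r`, this coefficient is a coefficient of the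
derivative. -/
theorem coeff_eq_zero_of_pderiv {F : Sym} {r : ℕ+} (h : pderiv r F = 0) {m : ℕ+ →₀ ℕ}
    (hm : m r ≠ 0) : coeff m F = 0 := by
  have h1 := congrArg (coeff (m - Finsupp.single r 1)) h
  rw [coeff_pderiv, tsub_add_cancel_of_le (by simpa [Nat.one_le_iff_ne_zero] using hm)] at h1
  simp only [coeff_zero, mul_eq_zero] at h1
  exact h1.resolve_right (Nat.cast_add_one_ne_zero _)

theorem HasDegree.eq_zero_of_pderiv {F : Sym} {d : ℤ} (hF : HasDegree F d) (hd : 0 < d)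
    (h : ∀ r, pderiv r F = 0) : F = 0 := by
  ext m
  by_contra hm
  have hm0 : m ≠ 0 := by
    rintro rfl
    have := hF hm
    simp at this
    omega
  obtain ⟨r, hr⟩ : ∃ r, m r ≠ 0 := by
    by_contra! hr
    exact hm0 (Finsupp.ext hr)
  exact hm (coeff_eq_zero_of_pderiv (h r) hr)

/-- A family of homogeneous elements vanishes if it vanishes in degree `0` and if its members have
vanishing partial derivatives whenever those of smaller degree vanish. -/
theorem eq_zero_of_hasDegree {ι : Type*} (deg : ι → ℤ) (T : ι → Sym)
    (hT : ∀ i, HasDegree (T i) (deg i)) (h0 : ∀ i, deg i = 0 → T i = 0)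
    (hd : ∀ i, (∀ j, deg j < deg i → T j = 0) → ∀ r, pderiv r (T i) = 0) (i : ι) :
    T i = 0 := by
  have key : ∀ (N : ℕ) (i : ι), deg i < N → T i = 0 := by
    intro N
    induction N with
    | zero => exact fun i hi => (hT i).eq_zero_of_neg (by simpa using hi)
    | succ N ih =>
      intro i hi
      rcases lt_trichotomy (deg i) 0 with h | h | h
      · exact (hT i).eq_zero_of_neg h
      · exact h0 i h
      · exact (hT i).eq_zero_of_pderiv h (hd i fun j hj => ih j (by push_cast at hi; omega))
  exact key ((deg i).toNat + 1) i (by push_cast; omega)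

/-! ### Homogeneous parts of exponentials of linear forms in the power sums -/

/-- The coefficient of `p_ρ` in `exp (∑ α_r p_r)`. -/
def expCoeff (α : ℕ+ → ℂ) (m : ℕ+ →₀ ℕ) : ℂ := m.prod fun r k => α r ^ k / (k ! : ℂ)

/-- The part of degree `n` of `exp (∑ α_r p_r)`. -/
def expPart (α : ℕ+ → ℂ) (n : ℤ) : Sym :=
  if 0 ≤ n then ∑ ρ : n.toNat.Partition, monomial (mults ρ) (expCoeff α (mults ρ)) else 0

theorem coeff_expPart (α : ℕ+ → ℂ) (n : ℤ) (m : ℕ+ →₀ ℕ) :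
    coeff m (expPart α n) = if Finsupp.weight degWeight m = n then expCoeff α m else 0 := by
  rw [expPart]
  split_ifs with h1 h2 h2
  · have h2' : Finsupp.weight degWeight m = n.toNat := by omega
    obtain ⟨ρ, rfl⟩ := exists_mults_eq h2'
    rw [coeff_sum, Finset.sum_eq_single ρ]
    · simp
    · intro σ _ hσ
      rw [coeff_monomial, if_neg fun h => hσ (mults_injective _ h)]
    · simp
  · rw [coeff_sum]
    refine Finset.sum_eq_zero fun σ _ => ?_
    rw [coeff_monomial, if_neg]
    rintro rfl
    rw [weight_mults] at h2
    omega
  · have := weight_nonneg m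
    omega
  · simp

theorem hasDegree_expPart (α : ℕ+ → ℂ) (n : ℤ) : HasDegree (expPart α n) n := by
  intro m hm
  rw [coeff_expPart] at hm
  by_contra h
  exact hm (if_neg h)

theorem expPart_zero (α : ℕ+ → ℂ) : expPart α 0 = 1 := by
  ext m
  rw [coeff_expPart, coeff_one]
  by_cases h : m = 0
  · subst h; simp [expCoeff]
  · rw [if_neg (Ne.symm h), if_neg fun h' => h (eq_zero_of_weight_eq_zero h')]

theorem expPart_of_neg (α : ℕ+ → ℂ) {n : ℤ} (hn : n < 0) : expPart α n = 0 :=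
  (hasDegree_expPart α n).eq_zero_of_neg hn

theorem prod_add_single_one {f : ℕ+ → ℕ → ℂ} (hf : ∀ r, f r 0 = 1) {m : ℕ+ →₀ ℕ} {r : ℕ+}
    {x : ℂ} (hx : f r (m r + 1) = x * f r (m r)) :
    (m + Finsupp.single r 1).prod f = x * m.prod f := by
  have h1 : ∀ m' : ℕ+ →₀ ℕ, m'.prod f = f r (m' r) * (m'.erase r).prod f := fun m' =>
    (Finsupp.mul_prod_erase' m' r f hf).symm
  have h2 : (m + Finsupp.single r 1).erase r = m.erase r := by
    rw [Finsupp.erase_add, Finsupp.erase_single, add_zero]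
  rw [h1 m, h1 (m + Finsupp.single r 1), h2, Finsupp.add_apply, Finsupp.single_eq_same, hx,
    mul_assoc]

theorem expCoeff_add_single (α : ℕ+ → ℂ) (m : ℕ+ →₀ ℕ) (r : ℕ+) :
    expCoeff α (m + Finsupp.single r 1) * (m r + 1) = α r * expCoeff α m := by
  have h2 : (m r : ℂ) + 1 ≠ 0 := Nat.cast_add_one_ne_zero _
  rw [expCoeff, prod_add_single_one (x := α r / (m r + 1)) (by simp), expCoeff]
  · field_simp
  · rw [Nat.factorial_succ]
    push_cast
    field_simp
    ring

theorem pderiv_expPart (α : ℕ+ → ℂ) (n : ℤ) (r : ℕ+) :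
    pderiv r (expPart α n) = C (α r) * expPart α (n - r) := by
  ext m
  rw [coeff_pderiv, coeff_C_mul, coeff_expPart, coeff_expPart, map_add, Finsupp.weight_single]
  simp only [one_smul]
  by_cases h : Finsupp.weight degWeight m + (r : ℤ) = n
  · rw [if_pos h, if_pos (by omega), expCoeff_add_single]
  · rw [if_neg h, if_neg (by omega)]
    simp

/-- Euler's identity: the operator ∑ r p_r ∂/∂p_r multiplies the part of degree n by n. It matches
the recursion in `IsExpSeq`. -/
theorem nsmul_expPart (α : ℕ+ → ℂ) (n : ℕ) :
    (n : Sym) * expPart α n =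
      ∑ r ∈ Finset.range n, C ((r + 1 : ℂ) * α r.succPNat) * (X r.succPNat *
        expPart α (n - (r + 1 : ℕ))) := by
  have hX : ∀ (r : ℕ+) (m : ℕ+ →₀ ℕ),
      α r * coeff m (X r * expPart α (n - r)) = m r * coeff m (expPart α n) := by
    intro r m
    rw [mul_comm (X r), coeff_mul_X']
    split_ifs with h
    · have hr : 1 ≤ m r := Nat.one_le_iff_ne_zero.2 (Finsupp.mem_support_iff.1 h)
      have hm : m = m - Finsupp.single r 1 + Finsupp.single r 1 :=
        (tsub_add_cancel_of_le (by simpa using hr)).symm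
      have h1 := congrArg (coeff (m - Finsupp.single r 1)) (pderiv_expPart α n r)
      rw [coeff_pderiv, coeff_C_mul, ← hm] at h1
      rw [← h1, mul_comm]
      congr 1
      simp only [Finsupp.coe_tsub, Pi.sub_apply, Finsupp.single_eq_same]
      push_cast [hr]
      ring
    · rw [Finsupp.notMem_support_iff.1 h]
      simp
  ext m
  rw [coeff_sum]
  have hterm : ∀ r ∈ Finset.range n, coeff m (C ((r + 1 : ℂ) * α r.succPNat) * (X r.succPNat *
        expPart α (n - (r + 1 : ℕ)))) =
        (((r + 1) * m r.succPNat : ℕ) : ℂ) * coeff m (expPart α n) := by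
    intro r _
    have := hX r.succPNat m
    rw [Nat.succPNat_coe, Nat.succ_eq_add_one] at this
    rw [coeff_C_mul, mul_assoc, this]
    push_cast
    ring
  rw [Finset.sum_congr rfl hterm, ← Finset.sum_mul, ← C_eq_coe_nat, coeff_C_mul]
  by_cases hm : Finsupp.weight degWeight m = n
  · congr 1
    rw [← Nat.cast_sum, Nat.cast_inj, ← Int.natCast_inj (m := n), ← hm, Finsupp.weight_apply,
      Finsupp.sum]
    -- A monomial of degree n contains only p_r with r ≤ n, so the truncated sum loses nothing.
    have hsub : m.support ⊆ (Finset.range n).map ⟨Nat.succPNat, Nat.succPNat_injective⟩ := by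
      intro r hr
      have h1 : (Finsupp.weight degWeight) (m - Finsupp.single r 1 + Finsupp.single r 1) = n := by
        rw [tsub_add_cancel_of_le, hm]
        simpa [Nat.one_le_iff_ne_zero] using hr
      rw [map_add, Finsupp.weight_single] at h1
      have h2 := weight_nonneg (m - Finsupp.single r 1)
      simp only [one_smul, degWeight] at h1
      have h3 := r.pos
      refine Finset.mem_map.2 ⟨r.natPred, Finset.mem_range.2 ?_, ?_⟩
      · rw [PNat.natPred]
        omega
      · exact PNat.succPNat_natPred r
    rw [Finset.sum_subset hsub, Finset.sum_map]
    · push_cast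
      refine Finset.sum_congr rfl fun r _ => ?_
      simp [degWeight, mul_comm]
    · intro r _ hr
      rw [Finsupp.notMem_support_iff.1 hr]
      simp
  · rw [coeff_expPart, if_neg hm]
    simp

/-! ### Translations of the power sums and vertex operators -/

theorem sym_induction {P : Sym → Prop} (F : Sym) (one : P 1)
    (add : ∀ F G, P F → P G → P (F + G)) (smul : ∀ (a : ℂ) F, P F → P (a • F))
    (X_mul : ∀ r F, P F → P (X r * F)) : P F := by
  induction F using MvPolynomial.induction_on with
  | C a =>
    have := smul a 1 one
    rwa [smul_eq_C_mul, mul_one] at this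
  | add F G hF hG => exact add F G hF hG
  | mul_X F r hF => rw [mul_comm]; exact X_mul r F hF

/-- The substitution `p_r ↦ p_r + c_r u ^ r`. -/
def shift (c : ℕ+ → ℂ) : Sym →ₐ[ℂ] Polynomial Sym :=
  aeval fun r => Polynomial.C (X r) + Polynomial.C (C (c r)) * Polynomial.X ^ (r : ℕ)

theorem shift_X_mul (c : ℕ+ → ℂ) (r : ℕ+) (F : Sym) :
    shift c (X r * F) = Polynomial.C (X r) * shift c F +
      Polynomial.C (C (c r)) * (shift c F * Polynomial.X ^ (r : ℕ)) := by
  rw [map_mul, shift, aeval_X]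
  ring

/-- The coefficient of `u ^ a` in the substitution `p_r ↦ p_r + c_r u ^ r`. -/
def skew (c : ℕ+ → ℂ) (a : ℕ) : Sym →ₗ[ℂ] Sym :=
  (Polynomial.lcoeff Sym a).restrictScalars ℂ ∘ₗ (shift c).toLinearMap

theorem skew_apply (c : ℕ+ → ℂ) (a : ℕ) (F : Sym) : skew c a F = (shift c F).coeff a := rfl

theorem skew_one (c : ℕ+ → ℂ) (a : ℕ) : skew c a 1 = if a = 0 then 1 else 0 := by
  rw [skew_apply, map_one, Polynomial.coeff_one]

theorem skew_X_mul (c : ℕ+ → ℂ) (a : ℕ) (r : ℕ+) (F : Sym) :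
    skew c a (X r * F) =
      X r * skew c a F + C (c r) * if (r : ℕ) ≤ a then skew c (a - r) F else 0 := by
  simp only [skew_apply, shift_X_mul, Polynomial.coeff_add, Polynomial.coeff_C_mul,
    Polynomial.coeff_mul_X_pow']

theorem pderiv_skew (c : ℕ+ → ℂ) (a : ℕ) (r : ℕ+) (F : Sym) :
    pderiv r (skew c a F) = skew c a (pderiv r F) := by
  induction F using sym_induction generalizing a with
  | one => rw [skew_one]; split_ifs <;> simp
  | add F G hF hG => simp only [map_add, hF, hG]
  | smul b F hF => simp only [map_smul, hF, Derivation.map_smul]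
  | X_mul s F hF =>
    simp only [skew_X_mul, map_add, pderiv_mul, pderiv_C, hF]
    by_cases hs : s = r
    · subst hs
      split_ifs
      · simp [hF]
        ring
      · simp
    · split_ifs <;> simp [pderiv_X_of_ne hs, hF]

theorem lsum_monomial (f : ℕ → Sym →ₗ[ℂ] Sym) (k : ℕ) (x : Sym) :
    Polynomial.lsum f (Polynomial.monomial k x) = f k x := by
  rw [Polynomial.lsum_apply, Polynomial.sum_monomial_index _ _ (by simp)]

/-- The coefficient of `z ^ m` of the vertex operator: multiplication by `exp (∑ α_r p_r z ^ r)`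
after the substitution `p_r ↦ p_r + c_r z ^ {-r}`. -/
def vertex (α c : ℕ+ → ℂ) (m : ℤ) : Sym →ₗ[ℂ] Sym :=
  Polynomial.lsum (fun a : ℕ => LinearMap.mulLeft ℂ (expPart α (m + a))) ∘ₗ (shift c).toLinearMap

theorem vertex_apply (α c : ℕ+ → ℂ) (m : ℤ) (F : Sym) :
    vertex α c m F = Polynomial.lsum (fun a : ℕ => LinearMap.mulLeft ℂ (expPart α (m + a)))
      (shift c F) := rfl

theorem vertex_eq_sum (α c : ℕ+ → ℂ) (m : ℤ) (F : Sym) (N : ℕ)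
    (hN : ∀ a, N ≤ a → skew c a F = 0) :
    vertex α c m F = ∑ a ∈ Finset.range N, expPart α (m + a) * skew c a F := by
  rw [vertex_apply, Polynomial.lsum_apply, Polynomial.sum_def]
  simp only [LinearMap.mulLeft_apply]
  refine Finset.sum_subset_zero_on_sdiff ?_ ?_ fun _ _ => rfl
  · intro a ha
    rw [Finset.mem_range]
    by_contra h
    exact (Polynomial.mem_support_iff.1 ha) (hN a (not_lt.1 h))
  · intro a ha
    rw [Finset.mem_sdiff, Polynomial.notMem_support_iff] at ha
    rw [skew_apply, ha.2, mul_zero]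

theorem vertex_one (α c : ℕ+ → ℂ) (m : ℤ) : vertex α c m 1 = expPart α m := by
  rw [vertex_eq_sum α c m 1 1 fun a ha => by rw [skew_one, if_neg (by omega)]]
  simp [skew_one]

/-- The substitution turns the factor p_r into p_r + c_r z^{-r}; the factor z^{-r} raises the index
of the coefficient by r. -/
theorem vertex_X_mul (α c : ℕ+ → ℂ) (m : ℤ) (r : ℕ+) (F : Sym) :
    vertex α c m (X r * F) = X r * vertex α c m F + C (c r) * vertex α c (m + r) F := by
  simp only [vertex_apply, shift_X_mul]
  generalize shift c F = p
  induction p using Polynomial.induction_on' with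
  | add p q hp hq =>
    simp only [mul_add, add_mul, map_add] at hp hq ⊢
    linear_combination hp + hq
  | monomial k x =>
    rw [Polynomial.C_mul_monomial, ← Polynomial.monomial_one_right_eq_X_pow,
      Polynomial.monomial_mul_monomial, Polynomial.C_mul_monomial, map_add]
    simp only [lsum_monomial, LinearMap.mulLeft_apply, mul_one]
    rw [show m + ((k + r : ℕ) : ℤ) = m + r + k by push_cast; ring]
    ring

/-- The substitution commutes with ∂/∂p_r, so the Leibniz rule adds only the derivative of the
exponential factor. -/
theorem pderiv_vertex (α c : ℕ+ → ℂ) (m : ℤ) (r : ℕ+) (F : Sym) :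
    pderiv r (vertex α c m F) =
      vertex α c m (pderiv r F) + C (α r) * vertex α c (m - r) F := by
  induction F using sym_induction generalizing m with
  | one => simp [vertex_one, pderiv_expPart]
  | add F G hF hG => simp only [map_add, hF, hG]; ring
  | smul b F hF => simp only [map_smul, hF, Derivation.map_smul, smul_add, mul_smul_comm]
  | X_mul s F hF =>
    have h1 : m + (s : ℤ) - r = m - r + s := by ring
    simp only [vertex_X_mul, map_add, pderiv_mul, pderiv_C, hF, h1]
    by_cases hs : s = r
    · subst hs
      rw [pderiv_X_self, one_mul, one_mul]
      ring
    · rw [pderiv_X_of_ne hs]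
      simp only [zero_mul, zero_add, map_zero]
      ring

theorem HasDegree.X_mul {F : Sym} {d : ℤ} (hF : HasDegree F d) (r : ℕ+) :
    HasDegree (X r * F) (d + r) := by
  have := (isWeightedHomogeneous_X ℂ degWeight r).mul hF
  rwa [add_comm] at this

/-- Homogeneity of the values of a linear map need only be checked on monomials. -/
theorem HasDegree.of_monomial {L : Sym →ₗ[ℂ] Sym} {f : ℤ → ℤ}
    (h : ∀ m : ℕ+ →₀ ℕ, HasDegree (L (monomial m 1)) (f (Finsupp.weight degWeight m)))
    {F : Sym} {d : ℤ} (hF : HasDegree F d) : HasDegree (L F) (f d) := by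
  rw [F.as_sum, map_sum]
  refine IsWeightedHomogeneous.sum _ _ _ fun m hm => ?_
  have hm1 : monomial m (coeff m F) = coeff m F • (monomial m 1 : Sym) := by
    rw [smul_monomial, smul_eq_mul, mul_one]
  rw [hm1, map_smul, smul_eq_C_mul]
  have := h m
  rw [hF (mem_support_iff.1 hm)] at this
  exact this.C_mul _

theorem monomial_induction {P : (ℕ+ →₀ ℕ) → Sym → Prop} (m : ℕ+ →₀ ℕ) (one : P 0 1)
    (X_mul : ∀ r m, P m (monomial m 1) →
      P (m + Finsupp.single r 1) (X r * monomial m 1)) : P m (monomial m 1) := by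
  obtain ⟨s, rfl⟩ := Multiset.toFinsupp.surjective m
  induction s using Multiset.induction_on with
  | empty => simpa using one
  | cons r s ih =>
    rw [← Multiset.singleton_add, map_add, Multiset.toFinsupp_singleton, add_comm]
    have := X_mul r _ ih
    rwa [X, monomial_mul, one_mul, add_comm (Finsupp.single r 1)] at this

theorem HasDegree.vertex {F : Sym} {d : ℤ} (hF : HasDegree F d) (α c : ℕ+ → ℂ) (k : ℤ) :
    HasDegree (vertex α c k F) (d + k) := by
  refine HasDegree.of_monomial (f := fun d => d + k) (fun m => ?_) hF
  refine monomial_induction (P := fun m F => ∀ k, HasDegree (CompoundBasis.vertex α c k F)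
    (Finsupp.weight degWeight m + k)) m ?_ ?_ k
  · intro k
    rw [vertex_one, map_zero, zero_add]
    exact hasDegree_expPart α k
  · intro r m h k
    rw [vertex_X_mul, map_add, Finsupp.weight_single, one_smul]
    refine IsWeightedHomogeneous.add ?_ ?_
    · convert (h k).X_mul r using 1
      ring
    · convert (h (k + r)).C_mul (c r) using 1
      ring

theorem HasDegree.skew {F : Sym} {d : ℤ} (hF : HasDegree F d) (c : ℕ+ → ℂ) (a : ℕ) :
    HasDegree (skew c a F) (d - a) := by
  refine HasDegree.of_monomial (f := fun d => d - a) (fun m => ?_) hF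
  refine monomial_induction (P := fun m F => ∀ a, HasDegree (CompoundBasis.skew c a F)
    (Finsupp.weight degWeight m - a)) m ?_ ?_ a
  · intro a
    rw [skew_one]
    split_ifs with h
    · subst h
      simpa using isWeightedHomogeneous_one ℂ degWeight
    · exact isWeightedHomogeneous_zero ℂ degWeight _
  · intro r m h a
    rw [skew_X_mul, map_add, Finsupp.weight_single, one_smul]
    refine IsWeightedHomogeneous.add ?_ ?_
    · convert (h a).X_mul r using 1
      ring
    · split_ifs with hr
      · convert (h (a - r)).C_mul (c r) using 1
        push_cast [hr]
        ring
      · rw [mul_zero]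
        exact isWeightedHomogeneous_zero ℂ degWeight _

/-! ### Bilinear forms and adjoints of vertex operators -/

/-- `z_ρ` with the factors `r` replaced by `w_r`. -/
def zeeW (w : ℕ+ → ℂ) (m : ℕ+ →₀ ℕ) : ℂ := m.prod fun r k => w r ^ k * (k ! : ℂ)

theorem zeeW_add_single (w : ℕ+ → ℂ) (m : ℕ+ →₀ ℕ) (r : ℕ+) :
    zeeW w (m + Finsupp.single r 1) = w r * (m r + 1) * zeeW w m := by
  refine prod_add_single_one (by simp) ?_
  rw [Nat.factorial_succ]
  push_cast
  ring

/-- The bilinear form with `⟨p_ρ, p_σ⟩ = δ_{ρσ} ∏ w_r ^ {m_r} m_r!`. -/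
def form (w : ℕ+ → ℂ) : Sym →ₗ[ℂ] Sym →ₗ[ℂ] ℂ :=
  (basisMonomials ℕ+ ℂ).constr ℂ fun m => zeeW w m • lcoeff ℂ m

theorem form_monomial (w : ℕ+ → ℂ) (m : ℕ+ →₀ ℕ) (a : ℂ) (G : Sym) :
    form w (monomial m a) G = a * zeeW w m * coeff m G := by
  have h : monomial m a = a • basisMonomials ℕ+ ℂ m := by
    rw [coe_basisMonomials, smul_monomial, smul_eq_mul, mul_one]
  rw [h, map_smul, form, Module.Basis.constr_basis]
  simp [mul_assoc]

theorem form_eq_sum (w : ℕ+ → ℂ) (F G : Sym) (s : Finset (ℕ+ →₀ ℕ)) (hs : F.support ⊆ s) :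
    form w F G = ∑ m ∈ s, coeff m F * zeeW w m * coeff m G := by
  conv_lhs => rw [F.as_sum, map_sum, LinearMap.sum_apply]
  simp only [form_monomial]
  refine Finset.sum_subset hs fun m _ hm => ?_
  rw [notMem_support_iff.1 hm, zero_mul, zero_mul]

theorem form_comm (w : ℕ+ → ℂ) (F G : Sym) : form w F G = form w G F := by
  classical
  rw [form_eq_sum w F G _ (Finset.subset_union_left (s₂ := G.support)),
    form_eq_sum w G F _ (Finset.subset_union_right (s₁ := F.support))]
  exact Finset.sum_congr rfl fun m _ => by ring

theorem form_X_mul (w : ℕ+ → ℂ) (r : ℕ+) (F G : Sym) :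
    form w (X r * F) G = w r * form w F (pderiv r G) := by
  rw [F.as_sum, Finset.mul_sum, map_sum, map_sum, LinearMap.sum_apply, LinearMap.sum_apply,
    Finset.mul_sum]
  refine Finset.sum_congr rfl fun m _ => ?_
  rw [X, monomial_mul, form_monomial, form_monomial, coeff_pderiv, add_comm, zeeW_add_single]
  ring

theorem form_one_left (w : ℕ+ → ℂ) (G : Sym) : form w 1 G = coeff 0 G := by
  have := form_monomial w 0 1 G
  simpa [zeeW] using this

theorem coeff_zero_expPart (α : ℕ+ → ℂ) (n : ℤ) :
    coeff 0 (expPart α n) = if n = 0 then 1 else 0 := by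
  rw [coeff_expPart, map_zero]
  simp [expCoeff, eq_comm]

theorem coeff_zero_X_mul (r : ℕ+) (F : Sym) : coeff 0 (X r * F) = 0 := by
  simp [coeff_X_mul']

/-- The adjoint of p_r is w_r ∂/∂p_r, so passing to adjoints exchanges the exponential factor with
the translation. The hypothesis makes the result a vertex operator with parameters -α, -c and with z
replaced by z⁻¹. -/
theorem form_vertex {w α c : ℕ+ → ℂ} (h : ∀ r, w r * α r = -c r) (m : ℤ) (F G : Sym) :
    form w (vertex α c m F) G = form w F (vertex (-α) (-c) (-m) G) := by
  induction F using sym_induction generalizing m G with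
  | one =>
    rw [vertex_one, form_one_left]
    induction G using sym_induction generalizing m with
    | one =>
      rw [vertex_one, form_comm, form_one_left, coeff_zero_expPart, coeff_zero_expPart]
      simp
    | add F G hF hG => simp only [map_add, hF, hG, coeff_add]
    | smul b F hF => simp only [map_smul, hF, coeff_smul]
    | X_mul r G hG =>
      rw [form_comm, form_X_mul, pderiv_expPart, ← smul_eq_C_mul, map_smul, form_comm, hG,
        smul_eq_mul, ← mul_assoc, h, vertex_X_mul, coeff_add, coeff_C_mul, coeff_zero_X_mul,
        neg_sub, zero_add, Pi.neg_apply, neg_add_eq_sub]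
  | add F F' hF hF' => simp only [map_add, LinearMap.add_apply, hF, hF']
  | smul b F hF => simp only [map_smul, LinearMap.smul_apply, hF]
  | X_mul r F hF =>
    have h1 : -(m + (r : ℤ)) = -m - r := by ring
    rw [vertex_X_mul, map_add, LinearMap.add_apply, form_X_mul, hF, ← smul_eq_C_mul, map_smul,
      LinearMap.smul_apply, hF, form_X_mul, pderiv_vertex, ← smul_eq_C_mul, map_add, map_smul, h1]
    simp only [smul_eq_mul, Pi.neg_apply]
    linear_combination form w F (vertex (-α) (-c) (-m - r) G) * h r

/-! ### Vertex operators applied to exponentials -/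

/-- `k` is the sequence of coefficients of `exp (∑ b_r u ^ r)`. -/
def IsExpSeq (b : ℕ+ → ℂ) (k : ℕ → ℂ) : Prop :=
  k 0 = 1 ∧ ∀ n : ℕ, (n + 1) * k (n + 1) =
    ∑ r ∈ Finset.range (n + 1), (r + 1) * b r.succPNat * k (n - r)

theorem coeff_zero_skew_expPart {β c : ℕ+ → ℂ} {k : ℕ → ℂ} (hk : IsExpSeq (β * c) k) (n : ℕ) :
    coeff 0 (skew c n (expPart β n)) = k n := by
  induction n using Nat.strong_induction_on with
  | _ n ih =>
  cases n with
  | zero => simp [expPart_zero, skew_one, hk.1]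
  | succ n =>
    have h1 := congrArg (fun F => coeff 0 (skew c (n + 1) F)) (nsmul_expPart β (n + 1))
    have h2 : ∀ r ∈ Finset.range (n + 1), coeff 0 (skew c (n + 1)
        (C ((r + 1 : ℂ) * β r.succPNat) * (X r.succPNat *
          expPart β ((n + 1 : ℕ) - (r + 1 : ℕ))))) =
        (r + 1) * (β * c) r.succPNat * k (n - r) := by
      intro r hr
      rw [Finset.mem_range] at hr
      have h3 : ((n + 1 : ℕ) : ℤ) - (r + 1 : ℕ) = (n - r : ℕ) := by omega
      rw [← smul_eq_C_mul, map_smul, coeff_smul, skew_X_mul, coeff_add, coeff_zero_X_mul,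
        coeff_C_mul, Nat.succPNat_coe, if_pos (by omega), h3,
        show n + 1 - r.succ = n - r by omega, ih (n - r) (by omega)]
      simp only [smul_eq_mul, Pi.mul_apply]
      ring
    simp only [map_sum, coeff_sum] at h1
    rw [Finset.sum_congr rfl h2, ← hk.2 n, ← C_eq_coe_nat, ← smul_eq_C_mul, map_smul, coeff_smul,
      smul_eq_mul] at h1
    push_cast at h1
    exact mul_left_cancel₀ (Nat.cast_add_one_ne_zero n) h1

/-- The substitution multiplies exp (∑ β_r p_r) by the scalar series exp (∑ β_r c_r u^r). Both sides
have the same derivatives by induction, and the constant in degree 0 comes from the Euler recursion.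
-/
theorem skew_expPart {β c : ℕ+ → ℂ} {k : ℕ → ℂ} (hk : IsExpSeq (β * c) k) (a : ℕ) (n : ℤ) :
    skew c a (expPart β n) = C (k a) * expPart β (n - a) := by
  rw [← sub_eq_zero]
  refine eq_zero_of_hasDegree (fun n : ℤ => n - a)
    (fun n => skew c a (expPart β n) - C (k a) * expPart β (n - a)) (fun n => ?_) (fun n hn => ?_)
    (fun n ih r => ?_) n
  · exact ((hasDegree_expPart β n).skew c a).sub ((hasDegree_expPart β _).C_mul _)
  · obtain rfl : n = a := by omega
    have h := (hasDegree_expPart β a).skew c a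
    rw [sub_self] at h
    simp only [sub_self, expPart_zero, mul_one]
    rw [HasDegree.eq_C h, coeff_zero_skew_expPart hk, sub_self]
  · have h := ih (n - r) (by have := r.pos; omega)
    have h1 : n - (a : ℤ) - r = n - r - a := by ring
    simp only [← smul_eq_C_mul] at h ⊢
    rw [map_sub, pderiv_skew, Derivation.map_smul, pderiv_expPart, pderiv_expPart,
      ← smul_eq_C_mul, ← smul_eq_C_mul, map_smul, h1, smul_comm (k a), ← smul_sub, h, smul_zero]

theorem vertex_expPart {α β c : ℕ+ → ℂ} {k : ℕ → ℂ} (hk : IsExpSeq (β * c) k) (m n : ℤ) :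
    vertex α c m (expPart β n) = ∑ a ∈ Finset.range (n.toNat + 1),
      expPart α (m + a) * (C (k a) * expPart β (n - a)) := by
  rw [vertex_eq_sum α c m _ (n.toNat + 1)]
  · exact Finset.sum_congr rfl fun a _ => by rw [skew_expPart hk]
  · intro a ha
    rw [skew_expPart hk, expPart_of_neg β (by omega), mul_zero]

/-- In total degree 0 only the summand a = n has both indices nonnegative. This is the degree-0 case
of the operator relations below. -/
theorem vertex_neg_expPart {α β c : ℕ+ → ℂ} {k : ℕ → ℂ} (hk : IsExpSeq (β * c) k) (n : ℤ) :
    vertex α c (-n) (expPart β n) = if 0 ≤ n then C (k n.toNat) else 0 := by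
  split_ifs with hn
  · rw [vertex_expPart hk, Finset.sum_range_succ, Finset.sum_eq_zero]
    · rw [Int.toNat_of_nonneg hn, sub_self, neg_add_cancel, expPart_zero, expPart_zero]
      simp
    · intro a ha
      rw [Finset.mem_range] at ha
      rw [expPart_of_neg α (by omega), zero_mul]
  · rw [expPart_of_neg β (by omega), map_zero]

theorem map_C_mul (L : Sym →ₗ[ℂ] Sym) (a : ℂ) (F : Sym) : L (C a * F) = C a * L F := by
  rw [← smul_eq_C_mul, map_smul, smul_eq_C_mul]

theorem vertex_vertex_X_mul (α c α' c' : ℕ+ → ℂ) (m n : ℤ) (r : ℕ+) (F : Sym) :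
    vertex α c m (vertex α' c' n (X r * F)) =
      X r * vertex α c m (vertex α' c' n F) + C (c r) * vertex α c (m + r) (vertex α' c' n F) +
        C (c' r) * vertex α c m (vertex α' c' (n + r) F) := by
  rw [vertex_X_mul, map_add, vertex_X_mul, map_C_mul]

theorem pderiv_vertex_expPart (α c β : ℕ+ → ℂ) (m n : ℤ) (r : ℕ+) :
    pderiv r (vertex α c m (expPart β n)) =
      C (β r) * vertex α c m (expPart β (n - r)) + C (α r) * vertex α c (m - r) (expPart β n) := by
  rw [pderiv_vertex, pderiv_expPart, map_C_mul]

/-! ### The operators for `h` and `q` and their commutation relations -/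

/-- `∑ p_r / r = log ∑ h_n`. -/
def hLog : ℕ+ → ℂ := fun r => (r : ℂ)⁻¹

/-- `∑ 2 p_r / r = log ∑ q_n`, the sum over the odd `r`. -/
def qLog : ℕ+ → ℂ := fun r => if Odd (r : ℕ) then 2 * (r : ℂ)⁻¹ else 0

/-- The indicator function of the odd numbers. -/
def oddInd : ℕ+ → ℂ := fun r => if Odd (r : ℕ) then 1 else 0

/-- exp (∑ u^r / r) = 1 / (1 - u). -/
theorem isExpSeq_one : IsExpSeq (hLog * 1) fun _ => 1 := by
  refine ⟨rfl, fun n => ?_⟩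
  have h : ∀ r ∈ Finset.range (n + 1), ((r : ℂ) + 1) * (hLog * 1) r.succPNat * 1 = 1 := by
    intro r _
    have : (r : ℂ) + 1 ≠ 0 := Nat.cast_add_one_ne_zero r
    simp [hLog, Nat.succPNat_coe, this]
  rw [Finset.sum_congr rfl h]
  simp

/-- exp (-∑ u^r / r) = 1 - u. -/
theorem isExpSeq_neg :
    IsExpSeq (hLog * -1) fun n => if n = 0 then 1 else if n = 1 then -1 else 0 := by
  refine ⟨rfl, fun n => ?_⟩
  have h : ∀ r ∈ Finset.range (n + 1), ((r : ℂ) + 1) * (hLog * -1) r.succPNat = -1 := by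
    intro r _
    have : (r : ℂ) + 1 ≠ 0 := Nat.cast_add_one_ne_zero r
    simp [hLog, Nat.succPNat_coe, this]
  rw [Finset.sum_congr rfl fun r hr => by rw [h r hr]]
  rcases n with _ | n
  · simp
  · rw [Finset.sum_range_succ, Finset.sum_range_succ, Finset.sum_eq_zero]
    · simp
    · intro r hr
      rw [Finset.mem_range] at hr
      dsimp only
      rw [if_neg (by omega), if_neg (by omega), mul_zero]

/-- exp (-∑ 2 u^r / r), summed over odd r, is (1 - u) / (1 + u) = 1 + 2 ∑_{n ≥ 1} (-u)^n. -/
theorem isExpSeq_odd :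
    IsExpSeq (qLog * -oddInd) fun n => if n = 0 then 1 else 2 * (-1) ^ n := by
  refine ⟨rfl, fun n => ?_⟩
  have h : ∀ r ∈ Finset.range (n + 1), ((r : ℂ) + 1) * (qLog * -oddInd) r.succPNat =
      -(1 + (-1) ^ r) := by
    intro r _
    have h0 : (r : ℂ) + 1 ≠ 0 := Nat.cast_add_one_ne_zero r
    rcases Nat.even_or_odd r with hr | hr
    · have h1 : Odd (r.succPNat : ℕ) := hr.add_one
      rw [Pi.mul_apply, Pi.neg_apply, qLog, oddInd, if_pos h1, if_pos h1, hr.neg_one_pow,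
        Nat.succPNat_coe, Nat.succ_eq_add_one]
      push_cast
      field_simp
      norm_num
    · have h1 : ¬ Odd (r + 1) := by simpa [Nat.even_add_one] using hr
      simp [qLog, oddInd, h1, hr.neg_one_pow]
  rw [Finset.sum_congr rfl fun r hr => by rw [h r hr]]
  have h2 : ∀ n : ℕ, ∑ r ∈ Finset.range n, -(1 + (-1 : ℂ) ^ r) * (2 * (-1) ^ (n - r)) =
      1 - (-1) ^ n - 2 * n * (-1) ^ n := by
    intro n
    have h3 : ∀ r ∈ Finset.range n, -(1 + (-1 : ℂ) ^ r) * (2 * (-1) ^ (n - r)) =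
        -2 * (-1) ^ n * ((-1) ^ r + 1) := by
      intro r hr
      have h4 : (-1 : ℂ) ^ n = (-1) ^ (n - r) * (-1) ^ r := by
        rw [← pow_add, Nat.sub_add_cancel (Finset.mem_range.1 hr).le]
      have h5 : ((-1 : ℂ) ^ r) ^ 2 = 1 := by rw [← pow_mul, mul_comm, pow_mul]; simp
      rw [h4]
      linear_combination (2 * (-1 : ℂ) ^ (n - r)) * h5
    have h5 : ((-1 : ℂ) ^ n) ^ 2 = 1 := by rw [← pow_mul, mul_comm, pow_mul]; simp
    rw [Finset.sum_congr rfl h3, ← Finset.mul_sum, Finset.sum_add_distrib,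
      geom_sum_eq (by norm_num)]
    simp only [Finset.sum_const, Finset.card_range, nsmul_eq_mul, mul_one]
    linear_combination h5
  have h6 : ∀ r ∈ Finset.range n, (if n - r = 0 then 1 else 2 * (-1 : ℂ) ^ (n - r)) =
      2 * (-1) ^ (n - r) := fun r hr => if_neg (by have := Finset.mem_range.1 hr; omega)
  dsimp only
  rw [Finset.sum_range_succ, Finset.sum_congr rfl fun r hr => by rw [h6 r hr], h2, pow_succ]
  simp
  ring

theorem hasDegree_C_ite (m : ℤ) (a : ℂ) : HasDegree (C (if m = 0 then a else 0)) m := by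
  split_ifs with h
  · rw [h]
    exact isWeightedHomogeneous_C _ _
  · rw [C_0]
    exact isWeightedHomogeneous_zero ℂ degWeight _

theorem neg_one_zpow_add_of_odd (m : ℤ) {r : ℕ} (hr : Odd r) :
    (-1 : ℂ) ^ (m + r) = -(-1) ^ m := by
  rw [zpow_add₀ (by norm_num), zpow_natCast, hr.neg_one_pow, mul_neg_one]

theorem neg_one_zpow_sub_of_odd (m : ℤ) {r : ℕ} (hr : Odd r) :
    (-1 : ℂ) ^ (m - r) = -(-1) ^ m := by
  have := neg_one_zpow_add_of_odd (m - r) hr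
  rw [sub_add_cancel] at this
  rw [this, neg_neg]

/-- The operators `Y_m` with `Q_λ = Y_{λ₁} Y_{λ₂} ⋯ 1`. -/
abbrev qVertex (m : ℤ) : Sym →ₗ[ℂ] Sym := vertex qLog (-oddInd) m

/-- The operators `B_m` with `S_λ = B_{λ₁} B_{λ₂} ⋯ 1`. -/
abbrev hVertex (m : ℤ) : Sym →ₗ[ℂ] Sym := vertex hLog (-1) m

/-- The adjoint of `B_m` is `E_{-m}`. -/
abbrev eVertex (m : ℤ) : Sym →ₗ[ℂ] Sym := vertex (-hLog) 1 m

theorem qVertex_neg_expPart (n : ℤ) : qVertex (-n) (expPart qLog n) =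
    if 0 ≤ n then C (if n.toNat = 0 then 1 else 2 * (-1) ^ n.toNat) else 0 :=
  vertex_neg_expPart isExpSeq_odd n

/-- Only odd r contribute to the derivatives; lowering m or n by an odd r gives right-hand sides of
opposite sign, which cancel. -/
theorem qVertex_expPart_add (m n : ℤ) :
    qVertex m (expPart qLog n) + qVertex n (expPart qLog m) =
      C (if m + n = 0 then 2 * (-1) ^ m else 0) := by
  rw [← sub_eq_zero]
  refine eq_zero_of_hasDegree (fun x : ℤ × ℤ => x.1 + x.2)
    (fun x => qVertex x.1 (expPart qLog x.2) + qVertex x.2 (expPart qLog x.1) -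
      C (if x.1 + x.2 = 0 then 2 * (-1) ^ x.1 else 0)) ?_ ?_ ?_ (m, n)
  · rintro ⟨m, n⟩
    refine (IsWeightedHomogeneous.add ?_ ((hasDegree_expPart _ _).vertex _ _ _)).sub
      (hasDegree_C_ite _ _)
    dsimp only
    rw [add_comm]
    exact (hasDegree_expPart _ _).vertex _ _ _
  · rintro ⟨m, n⟩ h
    dsimp only at h ⊢
    obtain rfl : m = -n := by omega
    have h1 := qVertex_neg_expPart n
    have h2 := qVertex_neg_expPart (-n)
    rw [neg_neg] at h2
    rw [h1, h2, if_pos h]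
    -- Only the term whose inner index is nonnegative survives; for n = 0 both survive with value 1,
    -- which accounts for the 2.
    rcases lt_trichotomy n 0 with hn | rfl | hn
    · rw [if_neg (by omega), if_pos (by omega), if_neg (by omega), zero_add, ← zpow_natCast,
        Int.toNat_of_nonneg (by omega), sub_self]
    · simp only [neg_zero, le_refl, if_true, Int.toNat_zero, zpow_zero, mul_one, ← C_add]
      rw [← C_sub]
      norm_num
    · rw [if_pos (by omega), if_neg (by omega), if_neg (by omega), add_zero, ← zpow_natCast,
        Int.toNat_of_nonneg (by omega), zpow_neg, ← inv_zpow, inv_neg_one, sub_self]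
  · rintro ⟨m, n⟩ ih r
    have hr := r.pos
    have h1 := ih (m, n - r) (by dsimp only; omega)
    have h2 := ih (m - r, n) (by dsimp only; omega)
    dsimp only at h1 h2 ⊢
    rw [map_sub, pderiv_C, sub_zero, map_add, pderiv_vertex_expPart, pderiv_vertex_expPart]
    by_cases hodd : Odd (r : ℕ)
    · rw [neg_one_zpow_sub_of_odd _ hodd] at h2
      have h3 : C (if m + (n - r) = 0 then 2 * (-1 : ℂ) ^ m else 0) +
          C (if m - r + n = 0 then 2 * -(-1 : ℂ) ^ m else 0) = (0 : Sym) := by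
        rw [show m - r + n = m + (n - r) by ring, ← C_add]
        split_ifs <;> simp
      linear_combination C (qLog r) * (h1 + h2) + C (qLog r) * h3
    · rw [qLog, if_neg hodd]
      simp

/-- Clifford relations. A factor p_r with r odd adds the relations for (m + r, n) and (m, n + r),
whose right-hand sides cancel, so everything reduces to the vector 1. -/
theorem qVertex_anticomm (m n : ℤ) (F : Sym) :
    qVertex m (qVertex n F) + qVertex n (qVertex m F) =
      (if m + n = 0 then 2 * (-1 : ℂ) ^ m else 0) • F := by
  induction F using sym_induction generalizing m n with
  | one => rw [vertex_one, vertex_one, qVertex_expPart_add, smul_eq_C_mul, mul_one]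
  | add F G hF hG =>
    simp only [map_add, smul_add] at hF hG ⊢
    rw [← hF, ← hG]
    abel
  | smul b F hF =>
    simp only [map_smul] at hF ⊢
    rw [← smul_add, hF, smul_comm]
  | X_mul r F hF =>
    rw [vertex_vertex_X_mul, vertex_vertex_X_mul]
    have h0 := hF m n
    have h1 := hF (m + r) n
    have h2 := hF m (n + r)
    by_cases hodd : Odd (r : ℕ)
    · rw [neg_one_zpow_add_of_odd _ hodd, show m + r + n = m + (n + r) by ring] at h1
      have h3 : (if m + (n + r) = 0 then 2 * -(-1 : ℂ) ^ m else 0) • F +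
          (if m + (n + r) = 0 then 2 * (-1 : ℂ) ^ m else 0) • F = 0 := by
        rw [← add_smul]
        split_ifs <;> simp
      simp only [smul_eq_C_mul] at *
      linear_combination X r * h0 + C ((-oddInd) r) * (h1 + h2 + h3)
    · simp only [Pi.neg_apply, oddInd, if_neg hodd, smul_eq_C_mul] at *
      simp only [neg_zero, C_0]
      linear_combination X r * h0

theorem eVertex_hVertex_one (m n : ℤ) :
    eVertex m (expPart hLog n) + hVertex (n + 1) (expPart (-hLog) (m - 1)) =
      C (if m + n = 0 then 1 else 0) := by
  rw [← sub_eq_zero]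
  refine eq_zero_of_hasDegree (fun x : ℤ × ℤ => x.1 + x.2)
    (fun x => eVertex x.1 (expPart hLog x.2) + hVertex (x.2 + 1) (expPart (-hLog) (x.1 - 1)) -
      C (if x.1 + x.2 = 0 then 1 else 0)) ?_ ?_ ?_ (m, n)
  · rintro ⟨m, n⟩
    refine (IsWeightedHomogeneous.add ?_ ?_).sub (hasDegree_C_ite _ _)
    · dsimp only
      rw [add_comm]
      exact (hasDegree_expPart _ _).vertex _ _ _
    · dsimp only
      rw [show m + n = m - 1 + (n + 1) by ring]
      exact (hasDegree_expPart _ _).vertex _ _ _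
  · rintro ⟨m, n⟩ h
    dsimp only at h ⊢
    obtain rfl : m = -n := by omega
    have h1 : eVertex (-n) (expPart hLog n) = _ := vertex_neg_expPart isExpSeq_one n
    have h2 : hVertex (-(-n - 1)) (expPart (-hLog) (-n - 1)) = _ :=
      vertex_neg_expPart (by rw [neg_mul_neg]; exact isExpSeq_one) (-n - 1)
    rw [show -(-n - 1) = n + 1 by ring] at h2
    rw [h1, h2, if_pos h]
    by_cases hn : 0 ≤ n
    · rw [if_pos hn, if_neg (by omega), add_zero, sub_self]
    · rw [if_neg hn, if_pos (by omega), zero_add, sub_self]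
  · rintro ⟨m, n⟩ ih r
    have hr := r.pos
    have h1 := ih (m, n - r) (by dsimp only; omega)
    have h2 := ih (m - r, n) (by dsimp only; omega)
    dsimp only at h1 h2 ⊢
    rw [map_sub, pderiv_C, sub_zero, map_add, pderiv_vertex_expPart, pderiv_vertex_expPart]
    rw [show m - r + n = m + (n - r) by ring] at h2
    rw [show n + 1 - r = n - r + 1 by ring, show m - 1 - r = m - r - 1 by ring]
    simp only [Pi.neg_apply, map_neg]
    linear_combination C (hLog r) * (h1 - h2)

/-- The fermionic relation between B and its adjoint. The two translations have parameters 1 and -1,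
so the extra terms produced by p_r cancel and only the vector 1 matters. -/
theorem eVertex_hVertex (m n : ℤ) (F : Sym) :
    eVertex m (hVertex n F) + hVertex (n + 1) (eVertex (m - 1) F) =
      (if m + n = 0 then (1 : ℂ) else 0) • F := by
  induction F using sym_induction generalizing m n with
  | one => rw [vertex_one, vertex_one, eVertex_hVertex_one, smul_eq_C_mul, mul_one]
  | add F G hF hG =>
    simp only [map_add, smul_add] at hF hG ⊢
    rw [← hF, ← hG]
    abel
  | smul b F hF =>
    simp only [map_smul] at hF ⊢
    rw [← smul_add, hF, smul_comm]
  | X_mul r F hF =>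
    rw [vertex_vertex_X_mul, vertex_vertex_X_mul]
    have h0 := hF m n
    have h1 := hF (m + r) n
    have h2 := hF m (n + r)
    rw [show m + r + n = m + (n + r) by ring, show m + r - 1 = m - 1 + r by ring] at h1
    rw [show n + r + 1 = n + 1 + r by ring] at h2
    simp only [smul_eq_C_mul, Pi.neg_apply, Pi.one_apply, map_neg, map_one] at *
    linear_combination X r * h0 + h1 - h2

/-! ### Identification of `h` and `q` with parts of exponentials -/

theorem expPart_natCast (α : ℕ+ → ℂ) (n : ℕ) :
    expPart α n = ∑ ρ : n.Partition, monomial (mults ρ) (expCoeff α (mults ρ)) :=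
  if_pos (Int.natCast_nonneg n)

theorem expCoeff_hLog (m : ℕ+ →₀ ℕ) : expCoeff hLog m = (zee m)⁻¹ := by
  rw [expCoeff, zee, Finsupp.prod, Finsupp.prod, ← Finset.prod_inv_distrib]
  refine Finset.prod_congr rfl fun r _ => ?_
  rw [hLog, mul_inv, inv_pow, div_eq_mul_inv]

theorem hInt_eq (k : ℤ) : hInt k = expPart hLog k := by
  rw [hInt, expPart]
  simp only [h, expCoeff_hLog]

theorem card_parts_eq_sum {n : ℕ} (ρ : n.Partition) :
    Multiset.card ρ.parts = ∑ r ∈ (mults ρ).support, mults ρ r := by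
  have h1 : Multiset.card ρ.parts = Multiset.card (Finsupp.toMultiset (mults ρ)) := by
    rw [mults, Multiset.toFinsupp_toMultiset, Multiset.card_map]
  rw [h1, Finsupp.card_toMultiset]
  rfl

theorem mem_support_mults {n : ℕ} (ρ : n.Partition) (r : ℕ+) :
    r ∈ (mults ρ).support ↔ (r : ℕ) ∈ ρ.parts := by
  rw [mults, Multiset.toFinsupp_support, Multiset.mem_toFinset, Multiset.mem_map]
  constructor
  · rintro ⟨i, hi, rfl⟩
    rwa [Nat.toPNat'_coe, if_pos (ρ.parts_pos hi)]
  · exact fun hr => ⟨r, hr, PNat.coe_toPNat' r⟩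

theorem q_eq (n : ℕ) : q n = expPart qLog n := by
  rw [expPart_natCast, q, Nat.Partition.odds, Nat.Partition.restricted, Finset.sum_filter]
  refine Finset.sum_congr rfl fun ρ _ => ?_
  split_ifs with hρ
  · congr 1
    rw [expCoeff, zee, Finsupp.prod, Finsupp.prod, card_parts_eq_sum, ← Finset.prod_pow_eq_pow_sum,
      ← Finset.prod_inv_distrib, ← Finset.prod_mul_distrib]
    refine Finset.prod_congr rfl fun r hr => ?_
    rw [qLog, if_pos (Nat.not_even_iff_odd.1 (hρ _ ((mem_support_mults ρ r).1 hr))), mul_pow,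
      mul_inv, inv_pow, div_eq_mul_inv, mul_assoc]
  · push Not at hρ
    obtain ⟨i, hi, hi'⟩ := hρ
    have hr : i.toPNat' ∈ (mults ρ).support := by
      rwa [mem_support_mults, Nat.toPNat'_coe, if_pos (ρ.parts_pos hi)]
    rw [expCoeff, Finsupp.prod, Finset.prod_eq_zero hr, monomial_zero]
    have h0 : ¬ Odd (i.toPNat' : ℕ) := by
      rwa [Nat.toPNat'_coe, if_pos (ρ.parts_pos hi), Nat.not_odd_iff_even]
    rw [qLog, if_neg h0, zero_pow (Finsupp.mem_support_iff.1 hr), zero_div]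

/-! ### Schur functions: orthonormality and the determinant formula -/

/-- The successive application to `1` of the vertex operators with indices in a list. -/
def vertexList (α c : ℕ+ → ℂ) : List ℕ → Sym
  | [] => 1
  | a :: l => vertex α c a (vertexList α c l)

theorem form_hVertex (m : ℤ) (F G : Sym) :
    form (fun r => (r : ℂ)) (hVertex m F) G = form (fun r => (r : ℂ)) F (eVertex (-m) G) := by
  have h := form_vertex (w := fun r : ℕ+ => (r : ℂ)) (α := hLog) (c := -1) (fun r => by
    simp [hLog]) m F G
  rwa [neg_neg] at h

/-- Moving E_{-b} past B_a with a < b leaves no scalar term and changes it to E_{-(b+1)}, still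
beyond all later parts; finally E of negative index annihilates 1. -/
theorem eVertex_neg_vertexList (b : ℤ) (hb : 0 < b) (L : List ℕ) (hL : ∀ a ∈ L, (a : ℤ) < b) :
    eVertex (-b) (vertexList hLog (-1) L) = 0 := by
  induction L generalizing b with
  | nil => rw [vertexList, vertex_one, expPart_of_neg _ (by omega)]
  | cons a L ih =>
    rw [List.forall_mem_cons] at hL
    have h := eVertex_hVertex (-b) a (vertexList hLog (-1) L)
    rw [show -b - 1 = -(b + 1) by ring, ih (b + 1) (by omega) fun x hx => by
      have := hL.2 x hx; omega, map_zero, add_zero, if_neg (by omega), zero_smul] at h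
    exact h

theorem form_vertexList_hLog (L M : List ℕ) (hL : L.Pairwise (· ≥ ·)) (hM : M.Pairwise (· ≥ ·))
    (hL0 : ∀ a ∈ L, 0 < a) (hM0 : ∀ a ∈ M, 0 < a) :
    form (fun r => (r : ℂ)) (vertexList hLog (-1) L) (vertexList hLog (-1) M) =
      if L = M then 1 else 0 := by
  -- If the first parts differ, the adjoint of the operator for the larger one annihilates the other
  -- vector.
  have lt : ∀ (a b : ℕ) (L M : List ℕ), (a :: L).Pairwise (· ≥ ·) → a < b →
      form (fun r => (r : ℂ)) (vertexList hLog (-1) (b :: M)) (vertexList hLog (-1) (a :: L)) =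
        0 := by
    intro a b L M hL hab
    rw [vertexList, form_hVertex, eVertex_neg_vertexList _ (by omega), map_zero]
    intro x hx
    rw [List.mem_cons] at hx
    rcases hx with rfl | hx
    · exact_mod_cast hab
    · exact_mod_cast ((List.pairwise_cons.1 hL).1 x hx).trans_lt hab
  have nil : ∀ (b : ℕ) (M : List ℕ), 0 < b →
      form (fun r => (r : ℂ)) (vertexList hLog (-1) (b :: M)) (vertexList hLog (-1) []) = 0 := by
    intro b M hb
    rw [vertexList.eq_2, form_hVertex, eVertex_neg_vertexList _ (by omega) _ (by simp), map_zero]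
  induction L generalizing M with
  | nil =>
    cases M with
    | nil => simp [vertexList, form_one_left]
    | cons b M => rw [form_comm, nil b M (hM0 b List.mem_cons_self), if_neg (by simp)]
  | cons a L ih =>
    cases M with
    | nil => rw [nil a L (hL0 a List.mem_cons_self), if_neg (by simp)]
    | cons b M =>
      rcases lt_trichotomy a b with hab | rfl | hab
      · rw [form_comm, lt a b L M hL hab, if_neg]
        rintro ⟨⟩
        exact lt_irrefl _ hab
      -- For equal first parts the relation reduces to E_{-a} B_a v = v, and both parts are removed.
      · have h := eVertex_hVertex (-a) a (vertexList hLog (-1) M)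
        rw [List.forall_mem_cons] at hL0 hM0
        rw [List.pairwise_cons] at hL hM
        rw [show -(a : ℤ) - 1 = -(a + 1) by ring, eVertex_neg_vertexList _ (by omega) _
          fun x hx => by have := hM.1 x hx; omega, map_zero, add_zero, if_pos (by omega),
          one_smul] at h
        rw [vertexList, vertexList, form_hVertex, h, ih M hL.2 hM.2 hL0.2 hM0.2]
        simp
      · rw [lt b a M L hM hab, if_neg]
        rintro ⟨⟩
        exact lt_irrefl _ hab

theorem shift_expPart_hLog (n : ℤ) : shift (-1) (expPart hLog n) =
    Polynomial.C (expPart hLog n) - Polynomial.X * Polynomial.C (expPart hLog (n - 1)) := by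
  ext1 a
  rw [← skew_apply, skew_expPart isExpSeq_neg, Polynomial.coeff_sub, Polynomial.coeff_C]
  rcases a with _ | _ | a
  · simp
  · simp
  · simp

/-- Translation replaces h_k by h_k - u h_{k-1}. The translated determinant of the tail is
therefore, after column operations, a determinant in untranslated entries bordered by the row (1, u,
u², …). Expanding along that row and letting the vertex operator replace u^j by h_{a+j} gives the
first-row expansion of the larger determinant. -/
theorem det_expPart_hLog (L : List ℕ) :
    Matrix.det (Matrix.of fun i j : Fin L.length =>
      expPart hLog ((L.get i : ℤ) - (i : ℤ) + (j : ℤ))) = vertexList hLog (-1) L := by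
  induction L with
  | nil => simp [vertexList]
  | cons a L ih =>
    rw [vertexList, ← ih, vertex_apply, AlgHom.map_det, Matrix.det_succ_row_zero]
    let f : Fin L.length → ℤ → Sym := fun i j => expPart hLog ((L.get i : ℤ) - (i : ℤ) + j)
    let N : Matrix (Fin (L.length + 1)) (Fin (L.length + 1)) (Polynomial Sym) :=
      Matrix.of fun i j => Fin.cases (Polynomial.X ^ (j : ℕ))
        (fun i => Polynomial.C (f i ((j : ℤ) - 1))) i
    let N' : Matrix (Fin (L.length + 1)) (Fin (L.length + 1)) (Polynomial Sym) :=
      Matrix.of fun i j => Fin.cases (Fin.cases 1 (fun _ => 0) j)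
        (fun i => Fin.cases (Polynomial.C (f i (-1)))
          (fun j => shift (-1) (f i j)) j) i
    -- Subtract u times the preceding column from each column after the first.
    have h1 : N.det = N'.det := by
      refine Matrix.det_eq_of_forall_col_eq_smul_add_pred (fun _ => Polynomial.X) ?_ ?_
      · intro i
        cases i using Fin.cases <;> simp [N, N']
      · intro i j
        cases i using Fin.cases with
        | zero => simp [N, N', pow_succ']
        | succ i =>
          simp only [N, N', Matrix.of_apply, Fin.cases_succ, f, shift_expPart_hLog, Fin.val_succ,
            Fin.val_castSucc]
          push_cast
          rw [add_sub_cancel_right, add_sub_assoc]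
          ring
    have h2 : N'.det = ((shift (-1)).mapMatrix (Matrix.of fun i j : Fin L.length =>
        expPart hLog ((L.get i : ℤ) - (i : ℤ) + (j : ℤ)))).det := by
      rw [Matrix.det_succ_row_zero, Fin.sum_univ_succ, Finset.sum_eq_zero]
      · simp [N', f]
        rfl
      · intro j _
        simp [N']
    rw [← h2, ← h1, Matrix.det_succ_row_zero, map_sum]
    refine Finset.sum_congr rfl fun j _ => ?_
    have h3 : (N.submatrix Fin.succ j.succAbove).det = Polynomial.C
        ((Matrix.of fun i j : Fin (a :: L).length =>
          expPart hLog (((a :: L).get i : ℤ) - (i : ℤ) + (j : ℤ))).submatrix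
            Fin.succ j.succAbove).det := by
      rw [RingHom.map_det]
      congr 1
      ext1 i k
      simp only [N, f, Matrix.submatrix_apply, Matrix.of_apply, Fin.cases_succ,
        RingHom.mapMatrix_apply, Matrix.map_apply]
      congr 2
      simp
      ring
    have h4 : (-1 : Polynomial Sym) ^ (j : ℕ) * N 0 j * (N.submatrix Fin.succ j.succAbove).det =
        Polynomial.monomial (j : ℕ) ((-1) ^ (j : ℕ) *
          ((Matrix.of fun i j : Fin (a :: L).length =>
          expPart hLog (((a :: L).get i : ℤ) - (i : ℤ) + (j : ℤ))).submatrix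
            Fin.succ j.succAbove).det) := by
      rw [h3, ← Polynomial.C_mul_X_pow_eq_monomial]
      simp only [N, Matrix.of_apply, Fin.cases_zero, map_mul, map_pow, map_neg, map_one]
      ring
    rw [h4, lsum_monomial]
    simp
    ring

theorem schur_eq_vertexList (ν : Multiset ℕ) :
    schur ν = vertexList hLog (-1) (ν.sort (· ≥ ·)) := by
  rw [← det_expPart_hLog, schur]
  simp only [hInt_eq]

theorem form_schur (ν ν' : Multiset ℕ) (h : ∀ a ∈ ν, 0 < a) (h' : ∀ a ∈ ν', 0 < a) :
    form (fun r => (r : ℂ)) (schur ν) (schur ν') = if ν = ν' then 1 else 0 := by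
  rw [schur_eq_vertexList, schur_eq_vertexList, form_vertexList_hLog]
  · congr 1
    refine propext ⟨fun h => ?_, fun h => by rw [h]⟩
    rw [← Multiset.sort_eq ν (· ≥ ·), h, Multiset.sort_eq]
  · exact Multiset.pairwise_sort _ _
  · exact Multiset.pairwise_sort _ _
  · simpa using h
  · simpa using h'

theorem hasDegree_vertexList (α c : ℕ+ → ℂ) (L : List ℕ) :
    HasDegree (vertexList α c L) (L.sum : ℕ) := by
  induction L with
  | nil => simpa [vertexList] using isWeightedHomogeneous_one ℂ degWeight
  | cons a L ih =>
    rw [List.sum_cons, add_comm, Nat.cast_add]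
    exact ih.vertex α c a

theorem sum_sort (ν : Multiset ℕ) : (ν.sort (· ≥ ·)).sum = ν.sum := by
  rw [← Multiset.sum_coe, Multiset.sort_eq]

theorem hasDegree_schur (ν : Multiset ℕ) : HasDegree (schur ν) (ν.sum : ℕ) := by
  rw [schur_eq_vertexList, ← sum_sort ν]
  exact hasDegree_vertexList _ _ _

/-! ### Q-functions: the Pfaffian as a product of vertex operators -/

/-- `Y_{a_1} ⋯ Y_{a_k} v`. -/
def qProd : (k : ℕ) → (Fin k → ℤ) → Sym → Sym
  | 0, _, v => v
  | k + 1, a, v => qVertex (a 0) (qProd k (fun i => a i.succ) v)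

theorem qProd_succ {k : ℕ} (a : Fin (k + 1) → ℤ) (v : Sym) :
    qProd (k + 1) a v = qVertex (a 0) (qProd k (fun i => a i.succ) v) := rfl

theorem qProd_zero_right {k : ℕ} (a : Fin k → ℤ) : qProd k a 0 = 0 := by
  induction k with
  | zero => rfl
  | succ k ih => rw [qProd_succ, ih, map_zero]

theorem hasDegree_qProd {k : ℕ} (a : Fin k → ℤ) : HasDegree (qProd k a 1) (∑ i, a i) := by
  induction k with
  | zero => simpa [qProd] using isWeightedHomogeneous_one ℂ degWeight
  | succ k ih =>
    rw [qProd_succ, Fin.sum_univ_succ, add_comm (a 0)]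
    exact (ih _).vertex _ _ _

theorem pderiv_qProd {k : ℕ} (a : Fin k → ℤ) (r : ℕ+) :
    pderiv r (qProd k a 1) =
      C (qLog r) * ∑ i, qProd k (Function.update a i (a i - r)) 1 := by
  induction k with
  | zero => simp [qProd]
  | succ k ih =>
    have h0 : qProd (k + 1) (Function.update a 0 (a 0 - r)) 1 =
        qVertex (a 0 - r) (qProd k (fun i => a i.succ) 1) := by
      rw [qProd_succ, Function.update_self]
      congr 1
    have h1 : ∀ i : Fin k, qProd (k + 1) (Function.update a i.succ (a i.succ - r)) 1 =
        qVertex (a 0) (qProd k (Function.update (fun i => a i.succ) i (a i.succ - r)) 1) := by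
      intro i
      rw [qProd_succ, Function.update_of_ne (Fin.succ_ne_zero i).symm]
      exact congrArg (fun f => qVertex (a 0) (qProd k f 1))
        (Function.update_comp_eq_of_injective a (Fin.succ_injective k) i (a i.succ - r))
    rw [qProd_succ, pderiv_vertex, ih, map_C_mul, map_sum, Fin.sum_univ_succ, h0]
    simp only [h1]
    ring

/-- Y_b is moved through all factors by the Clifford relations; each transposition costs a sign and
leaves a scalar. -/
theorem qVertex_qProd {k : ℕ} (b : ℤ) (a : Fin (k + 1) → ℤ) (v : Sym) :
    qVertex b (qProd (k + 1) a v) =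
      ∑ j : Fin (k + 1), ((-1) ^ (j : ℕ) * if b + a j = 0 then 2 * (-1 : ℂ) ^ b else 0) •
        qProd k (fun x => a (j.succAbove x)) v +
      (-1 : ℂ) ^ (k + 1) • qProd (k + 1) a (qVertex b v) := by
  induction k with
  | zero =>
    have h := qVertex_anticomm b (a 0) v
    simp only [qProd, Fin.sum_univ_succ, Fin.sum_univ_zero, add_zero]
    simp only [Fin.val_zero, pow_zero, one_mul, zero_add, pow_one, neg_smul, one_smul]
    rw [← h]
    abel
  | succ k ih =>
    have h := qVertex_anticomm b (a 0) (qProd (k + 1) (fun i => a i.succ) v)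
    rw [← eq_sub_iff_add_eq] at h
    rw [qProd_succ, h, ih, map_add, map_sum, Fin.sum_univ_succ (n := k + 1)]
    simp only [map_smul, Fin.val_succ, Fin.succ_succAbove_zero, Fin.succ_succAbove_succ, qProd_succ,
      Fin.val_zero, Fin.zero_succAbove, pow_zero, one_mul, pow_succ _ (_ + 1), mul_neg_one,
      neg_smul]
    simp only [pow_succ, mul_neg_one, neg_smul, neg_mul, Finset.sum_neg_distrib, neg_neg]
    abel

/-- `Q_{(a, b)} = Y_a Y_b 1`. -/
def qPair (a b : ℤ) : Sym := qVertex a (expPart qLog b)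

theorem hasDegree_qPair (a b : ℤ) : HasDegree (qPair a b) (a + b) := by
  rw [add_comm]
  exact (hasDegree_expPart _ _).vertex _ _ _

/-- The expansion along the first row of the Pfaffian of `Q_{(a_i, a_j)}`. -/
def qRow {k : ℕ} (a : Fin (k + 2) → ℤ) : Sym :=
  ∑ j : Fin (k + 1), (-1) ^ (j : ℕ) * qPair (a 0) (a j.succ) *
    qProd k (fun x => a (j.succAbove x).succ) 1

theorem sum_eq_add_add {k : ℕ} (a : Fin (k + 2) → ℤ) (j : Fin (k + 1)) :
    ∑ i, a i = a 0 + a j.succ + ∑ x, a (j.succAbove x).succ := by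
  rw [Fin.sum_univ_succ, Fin.sum_univ_succAbove _ j]
  ring

theorem hasDegree_qRow {k : ℕ} (a : Fin (k + 2) → ℤ) : HasDegree (qRow a) (∑ i, a i) := by
  refine IsWeightedHomogeneous.sum _ _ _ fun j _ => ?_
  rw [sum_eq_add_add a j]
  have h : ((-1) ^ (j : ℕ) : Sym) = C ((-1) ^ (j : ℕ)) := by simp
  rw [h]
  exact ((hasDegree_qPair _ _).C_mul _).mul (hasDegree_qProd _)

/-- Each index occurs exactly once in each summand, so differentiation lowers every index in turn,
exactly as in `pderiv_qProd`. -/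
theorem pderiv_qRow {k : ℕ} (a : Fin (k + 2) → ℤ) (r : ℕ+) :
    pderiv r (qRow a) = C (qLog r) * ∑ i, qRow (Function.update a i (a i - r)) := by
  have h1 : ∀ j : Fin (k + 1), qRow (Function.update a 0 (a 0 - r)) =
      ∑ j : Fin (k + 1), (-1) ^ (j : ℕ) * qPair (a 0 - r) (a j.succ) *
        qProd k (fun x => a (j.succAbove x).succ) 1 := by
    intro j
    simp [qRow]
  have h2 : ∀ j : Fin (k + 1), (fun x => Function.update a j.succ (a j.succ - r)
      (j.succAbove x).succ) = fun x => a (j.succAbove x).succ := by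
    intro j
    ext x
    rw [Function.update_of_ne]
    exact fun h => Fin.succAbove_ne j x (Fin.succ_injective _ h)
  have h3 : ∀ (j : Fin (k + 1)) (y : Fin k),
      (fun x => Function.update a (j.succAbove y).succ (a (j.succAbove y).succ - r)
        (j.succAbove x).succ) =
      Function.update (fun x => a (j.succAbove x).succ) y (a (j.succAbove y).succ - r) := by
    intro j y
    exact Function.update_comp_eq_of_injective a (f := fun x => (j.succAbove x).succ)
      ((Fin.succ_injective _).comp Fin.succAbove_right_injective) y _
  have h4 : ∀ (j : Fin (k + 1)) (y : Fin k), Function.update a (j.succAbove y).succ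
      (a (j.succAbove y).succ - r) j.succ = a j.succ := by
    intro j y
    rw [Function.update_of_ne]
    exact fun h => Fin.succAbove_ne j y (Fin.succ_injective _ h).symm
  rw [Fin.sum_univ_succ, h1 0]
  simp only [qRow]
  rw [Finset.sum_comm, ← Finset.sum_add_distrib, map_sum, Finset.mul_sum]
  refine Finset.sum_congr rfl fun j _ => ?_
  rw [Fin.sum_univ_succAbove _ j]
  simp only [h2, h3, h4, Function.update_self,
    Function.update_of_ne (Fin.succ_ne_zero _).symm]
  have h5 : pderiv r ((-1) ^ (j : ℕ) : Sym) = 0 := by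
    rw [show ((-1) ^ (j : ℕ) : Sym) = C ((-1) ^ (j : ℕ)) by simp, pderiv_C]
  rw [pderiv_mul, pderiv_mul, h5, pderiv_qProd, ← Finset.mul_sum, qPair, pderiv_vertex_expPart,
    ← qPair, ← qPair, ← qPair]
  ring

/-- The degrees of the factors add up to 0, so unless both vanish one factor has negative degree and
is zero. -/
theorem qPair_mul_of_sum_eq_zero {k : ℕ} (a : Fin (k + 2) → ℤ) (ha : ∑ i, a i = 0)
    (j : Fin (k + 1)) :
    qPair (a 0) (a j.succ) * qProd k (fun x => a (j.succAbove x).succ) 1 =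
      (if a 0 + a j.succ = 0 then
        (if a 0 < 0 then 2 * (-1 : ℂ) ^ (a 0) else if a 0 = 0 then 1 else 0) else 0) •
        qProd k (fun x => a (j.succAbove x).succ) 1 := by
  have hs := sum_eq_add_add a j
  rcases lt_trichotomy (a 0 + a j.succ) 0 with h | h | h
  · rw [(hasDegree_qPair _ _).eq_zero_of_neg h, if_neg h.ne, zero_mul, zero_smul]
  · rw [if_pos h, smul_eq_C_mul]
    congr 1
    generalize a j.succ = b at h ⊢
    generalize a 0 = c at h ⊢
    obtain rfl : c = -b := by omega
    rw [qPair, qVertex_neg_expPart]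
    rcases lt_trichotomy b 0 with hb | rfl | hb
    · rw [if_neg (by omega), if_neg (by omega), if_neg (by omega), C_0]
    · simp
    · rw [if_pos (by omega), if_neg (by omega), if_pos (by omega), ← zpow_natCast,
        Int.toNat_of_nonneg (by omega), zpow_neg, ← inv_zpow, inv_neg_one]
  · rw [(hasDegree_qProd _).eq_zero_of_neg (by omega), mul_zero, smul_zero]

/-- Y_{a_0} is moved past the other 2m + 1 factors, an odd number, hence the sign -1. If a_0 < 0 it
annihilates 1. If a_0 > 0 the remaining product has negative degree and both sides vanish. If a_0 =
0 it fixes constants, and the identity becomes twice the assertion. -/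
theorem qProd_eq_qRow_of_sum_eq_zero {m : ℕ} (a : Fin (2 * m + 2) → ℤ) (ha : ∑ i, a i = 0) :
    qProd (2 * m + 2) a 1 = qRow a := by
  have h := qVertex_qProd (a 0) (fun i => a i.succ) 1
  rw [← qProd_succ, vertex_one, Odd.neg_one_pow ⟨m, rfl⟩, neg_smul, one_smul] at h
  have hrow : qRow a = ∑ j : Fin (2 * m + 1), ((-1) ^ (j : ℕ) * if a 0 + a j.succ = 0 then
        (if a 0 < 0 then 2 * (-1 : ℂ) ^ (a 0) else if a 0 = 0 then 1 else 0) else 0) •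
        qProd (2 * m) (fun x => a (j.succAbove x).succ) 1 := by
    refine Finset.sum_congr rfl fun j _ => ?_
    rw [mul_assoc, qPair_mul_of_sum_eq_zero a ha, mul_smul, smul_eq_C_mul _ ((-1 : ℂ) ^ (j : ℕ))]
    simp
  have hdeg := hasDegree_qProd (fun i => a (Fin.succ i))
  rw [Fin.sum_univ_succ] at ha
  rcases lt_trichotomy (a 0) 0 with h0 | h0 | h0
  · rw [hrow, h, expPart_of_neg _ h0, qProd_zero_right, neg_zero, add_zero]
    simp only [if_pos h0]
  · have h1 : qProd (2 * m + 2) a 1 = qProd (2 * m + 1) (fun i => a i.succ) 1 := by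
      rw [show ∑ i : Fin (2 * m + 1), a i.succ = 0 by omega] at hdeg
      rw [qProd_succ, hdeg.eq_C, ← mul_one (C _), map_C_mul, h0, vertex_one, expPart_zero]
    rw [h0, expPart_zero, ← h1] at h
    rw [hrow, h0]
    have h2 : (2 : ℂ) • qProd (2 * m + 2) a 1 = (2 : ℂ) • qRow a := by
      rw [hrow, h0, two_smul, Finset.smul_sum]
      nth_rewrite 1 [h]
      rw [neg_add_cancel_right]
      refine Finset.sum_congr rfl fun j _ => ?_
      rw [smul_smul]
      congr 1
      simp only [lt_irrefl, if_false, if_true, zpow_zero, mul_one]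
      split_ifs
      · ring
      · simp
    rw [hrow, h0] at h2
    exact smul_right_injective _ (two_ne_zero) h2
  · rw [hrow, qProd_succ, hdeg.eq_zero_of_neg (by omega), map_zero, Finset.sum_eq_zero]
    intro j _
    rw [if_neg h0.not_gt, if_neg h0.ne']
    simp

/-- Both sides satisfy the same system of derivatives and agree in degree 0. -/
theorem qProd_eq_qRow {m : ℕ} (a : Fin (2 * m + 2) → ℤ) : qProd (2 * m + 2) a 1 = qRow a := by
  rw [← sub_eq_zero]
  refine eq_zero_of_hasDegree (fun a : Fin (2 * m + 2) → ℤ => ∑ i, a i)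
    (fun a => qProd (2 * m + 2) a 1 - qRow a) (fun a => ?_) (fun a ha => ?_) (fun a ih r => ?_) a
  · exact (hasDegree_qProd a).sub (hasDegree_qRow a)
  · rw [qProd_eq_qRow_of_sum_eq_zero a ha, sub_self]
  · rw [map_sub, pderiv_qProd, pderiv_qRow, ← mul_sub, ← Finset.sum_sub_distrib,
      Finset.sum_eq_zero, mul_zero]
    intro i _
    refine ih _ ?_
    rw [Finset.sum_update_of_mem (Finset.mem_univ i),
      ← Finset.add_sum_erase _ _ (Finset.mem_univ i), Finset.sdiff_singleton_eq_erase]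
    have := r.pos
    omega

theorem qTwo_eq_qPair {r s : ℕ} (h : r ≠ s) : qTwo r s = qPair r s := by
  have h1 : ∀ i ∈ Finset.range s, expPart qLog ((r : ℤ) + (i + 1 : ℕ)) *
      (C (if i + 1 = 0 then 1 else 2 * (-1) ^ (i + 1)) * expPart qLog ((s : ℤ) - (i + 1 : ℕ))) =
      2 * ((-1) ^ (1 + i) * (q (r + (1 + i)) * q (s - (1 + i)))) := by
    intro i hi
    rw [Finset.mem_range] at hi
    rw [q_eq, q_eq, if_neg (Nat.succ_ne_zero i), Nat.cast_sub (by omega), add_comm 1 i,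
      Nat.cast_add r, map_mul, map_pow, map_neg, map_one, map_ofNat]
    ring
  rw [qTwo, if_neg h, qPair, qVertex, vertex_expPart isExpSeq_odd, Int.toNat_natCast,
    Finset.sum_range_succ', Finset.sum_congr rfl h1, ← Finset.Ico_add_one_right_eq_Icc,
    Finset.sum_Ico_eq_sum_range, Finset.mul_sum, Nat.add_sub_cancel, if_pos rfl, C_1, one_mul,
    Nat.cast_zero, add_zero, sub_zero, q_eq, q_eq, add_comm]

/-- The row expansion uses only pairs of distinct positions; injectivity keeps it off the diagonal,
where `qTwo` is 0 by convention. -/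
theorem pfaffian_qTwo {m : ℕ} (s : Fin (2 * m) → ℕ) (hs : Function.Injective s) :
    pfaffian m (Matrix.of fun i j => qTwo (s i) (s j)) = qProd (2 * m) (fun i => (s i : ℤ)) 1 := by
  induction m with
  | zero => rfl
  | succ m ih =>
    refine Eq.trans ?_ (qProd_eq_qRow (m := m) fun i => (s i : ℤ)).symm
    refine Finset.sum_congr rfl fun j _ => ?_
    have h := ih (fun x => s (j.succAbove x).succ)
      (hs.comp ((Fin.succ_injective _).comp Fin.succAbove_right_injective))
    have h' : qTwo (s 0) (s j.succ) = qPair (s 0) (s j.succ) :=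
      qTwo_eq_qPair fun h' => Fin.succ_ne_zero j (hs h').symm
    rw [← h, ← h']
    rfl

/-- A padding part 0 is harmless, since Y_0 1 = 1. -/
theorem qProd_getD (L : List ℕ) (k : ℕ) (hk : k = L.length ∨ k = L.length + 1) :
    qProd k (fun i => ((L.getD i 0 : ℕ) : ℤ)) 1 = vertexList qLog (-oddInd) L := by
  induction L generalizing k with
  | nil =>
    rcases hk with rfl | rfl
    · rfl
    · simp [qProd, vertex_one, expPart_zero, vertexList]
  | cons a L ih =>
    obtain ⟨k, rfl⟩ : ∃ k', k = k' + 1 := ⟨k - 1, by rw [List.length_cons] at hk; omega⟩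
    rw [qProd_succ, vertexList, ← ih k (by rw [List.length_cons] at hk; omega)]
    rfl

theorem getD_injective (L : List ℕ) (hL : L.Pairwise (· > ·)) (h0 : ∀ a ∈ L, 0 < a) (k : ℕ)
    (hk : k ≤ L.length + 1) : Function.Injective fun i : Fin k => L.getD i 0 := by
  have lt : ∀ i j : Fin k, i < j → L.getD j 0 < L.getD i 0 := by
    intro i j hij
    have hi : (i : ℕ) < L.length := by have := j.2; have : (i : ℕ) < j := hij; omega
    rw [List.getD_eq_getElem _ _ hi]
    by_cases hj : (j : ℕ) < L.length
    · rw [List.getD_eq_getElem _ _ hj]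
      exact List.pairwise_iff_getElem.1 hL _ _ _ _ hij
    · rw [List.getD_eq_default _ _ (not_lt.1 hj)]
      exact h0 _ (List.getElem_mem hi)
  intro i j hij
  rcases lt_trichotomy i j with h | h | h
  · exact absurd hij (lt i j h).ne'
  · exact h
  · exact absurd hij (lt j i h).ne

theorem sort_pairwise_gt {l : Multiset ℕ} (hl : l.Nodup) :
    (l.sort (· ≥ ·)).Pairwise (· > ·) := by
  have h1 : (l.sort (· ≥ ·)).Nodup := by rwa [← Multiset.coe_nodup, Multiset.sort_eq]
  exact ((Multiset.pairwise_sort l (· ≥ ·)).and h1).imp fun h => lt_of_le_of_ne h.1 h.2.symm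

theorem schurQ_eq_vertexList (l : Multiset ℕ) (hl : l.Nodup) (h0 : ∀ a ∈ l, 0 < a) :
    schurQ l = vertexList qLog (-oddInd) (l.sort (· ≥ ·)) := by
  have hlen : (l.sort (· ≥ ·)).length = Multiset.card l := Multiset.length_sort _
  rw [schurQ, ← qProd_getD _ (2 * ((Multiset.card l + 1) / 2)) (by omega)]
  exact pfaffian_qTwo _ (getD_injective _ (sort_pairwise_gt hl) (by simpa using h0) _ (by omega))

/-! ### Orthogonality of the Q-functions -/

theorem expPart_neg_qLog (m : ℤ) : expPart (-qLog) m = (-1 : ℂ) ^ m • expPart qLog m := by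
  rw [← sub_eq_zero]
  refine eq_zero_of_hasDegree (fun m : ℤ => m)
    (fun m => expPart (-qLog) m - (-1 : ℂ) ^ m • expPart qLog m) (fun m => ?_) (fun m hm => ?_)
    (fun m ih r => ?_) m
  · rw [smul_eq_C_mul]
    exact (hasDegree_expPart _ _).sub ((hasDegree_expPart _ _).C_mul _)
  · rw [hm, expPart_zero, expPart_zero, zpow_zero, one_smul, sub_self]
  · have h := ih (m - r) (by have := r.pos; omega)
    rw [map_sub, Derivation.map_smul, pderiv_expPart, pderiv_expPart]
    by_cases hodd : Odd (r : ℕ)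
    · rw [neg_one_zpow_sub_of_odd _ hodd] at h
      simp only [smul_eq_C_mul, Pi.neg_apply, map_neg] at h ⊢
      linear_combination -C (qLog r) * h
    · simp [qLog, hodd]

theorem vertex_neg_qLog (m : ℤ) (F : Sym) :
    vertex (-qLog) (- -oddInd) m F = (-1 : ℂ) ^ m • qVertex m F := by
  induction F using sym_induction generalizing m with
  | one => rw [vertex_one, vertex_one, expPart_neg_qLog]
  | add F G hF hG => rw [map_add, hF, hG, map_add, smul_add]
  | smul b F hF => rw [map_smul, hF, map_smul, smul_comm]
  | X_mul r F hF =>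
    rw [vertex_X_mul, vertex_X_mul, hF, hF]
    by_cases hodd : Odd (r : ℕ)
    · rw [neg_one_zpow_add_of_odd _ hodd]
      simp only [smul_eq_C_mul, Pi.neg_apply, map_neg]
      ring
    · simp [oddInd, hodd]

/-- With weights r / 2 the parameters satisfy w_r α_r = -c_r; since only odd r occur, negating them
amounts to z ↦ -z. So Y_{-m} is, up to sign, the adjoint of Y_m. -/
theorem form_qVertex (m : ℤ) (F G : Sym) :
    form (fun r => (r : ℂ) / 2) (qVertex m F) G =
      (-1) ^ m * form (fun r => (r : ℂ) / 2) F (qVertex (-m) G) := by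
  have h := form_vertex (w := fun r : ℕ+ => (r : ℂ) / 2) (α := qLog) (c := -oddInd) (fun r => by
    rw [Pi.neg_apply, neg_neg, qLog, oddInd]
    have hr : (r : ℂ) ≠ 0 := Nat.cast_ne_zero.2 r.ne_zero
    split_ifs
    · field_simp
    · rw [mul_zero]) m F G
  rw [h, vertex_neg_qLog, map_smul, smul_eq_mul, zpow_neg, ← inv_zpow, inv_neg_one]

theorem qVertex_neg_vertexList (b : ℤ) (hb : 0 < b) (L : List ℕ) (hL : ∀ a ∈ L, (a : ℤ) < b) :
    qVertex (-b) (vertexList qLog (-oddInd) L) = 0 := by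
  induction L with
  | nil => rw [vertexList, vertex_one, expPart_of_neg _ (by omega)]
  | cons a L ih =>
    rw [List.forall_mem_cons] at hL
    have h := qVertex_anticomm (-b) a (vertexList qLog (-oddInd) L)
    rw [ih hL.2, map_zero, add_zero, if_neg (by omega), zero_smul] at h
    exact h

theorem form_vertexList_qLog (L M : List ℕ) (hL : L.Pairwise (· > ·)) (hM : M.Pairwise (· > ·))
    (hL0 : ∀ a ∈ L, 0 < a) (hM0 : ∀ a ∈ M, 0 < a) :
    form (fun r => (r : ℂ) / 2) (vertexList qLog (-oddInd) L) (vertexList qLog (-oddInd) M) =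
      if L = M then 2 ^ L.length else 0 := by
  have lt : ∀ (a b : ℕ) (L M : List ℕ), (a :: L).Pairwise (· > ·) → a < b →
      form (fun r => (r : ℂ) / 2) (vertexList qLog (-oddInd) (b :: M))
        (vertexList qLog (-oddInd) (a :: L)) = 0 := by
    intro a b L M hL hab
    rw [vertexList, form_qVertex, qVertex_neg_vertexList _ (by omega), map_zero, mul_zero]
    intro x hx
    rw [List.mem_cons] at hx
    rcases hx with rfl | hx
    · exact_mod_cast hab
    · exact_mod_cast ((List.pairwise_cons.1 hL).1 x hx).trans hab
  have nil : ∀ (b : ℕ) (M : List ℕ), 0 < b →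
      form (fun r => (r : ℂ) / 2) (vertexList qLog (-oddInd) (b :: M))
        (vertexList qLog (-oddInd) []) = 0 := by
    intro b M hb
    rw [vertexList.eq_2, form_qVertex, qVertex_neg_vertexList _ (by omega) _ (by simp), map_zero,
      mul_zero]
  induction L generalizing M with
  | nil =>
    cases M with
    | nil => simp [vertexList, form_one_left]
    | cons b M => rw [form_comm, nil b M (hM0 b List.mem_cons_self), if_neg (by simp)]
  | cons a L ih =>
    cases M with
    | nil => rw [nil a L (hL0 a List.mem_cons_self), if_neg (by simp)]
    | cons b M =>
      rcases lt_trichotomy a b with hab | rfl | hab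
      · rw [form_comm, lt a b L M hL hab, if_neg]
        rintro ⟨⟩
        exact lt_irrefl _ hab
      -- Each common part contributes a 2 from the Clifford relation; its sign (-1)^a cancels the
      -- one from the adjoint.
      · have h := qVertex_anticomm (-a) a (vertexList qLog (-oddInd) M)
        rw [List.forall_mem_cons] at hL0 hM0
        rw [List.pairwise_cons] at hL hM
        rw [qVertex_neg_vertexList _ (by omega) _
          fun x hx => by have := hM.1 x hx; omega, map_zero, add_zero, if_pos (by omega)] at h
        have h1 : ((-1 : ℂ) ^ a) ^ 2 = 1 := by rw [← pow_mul, mul_comm, pow_mul]; simp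
        rw [vertexList, vertexList, form_qVertex, h, map_smul, ih M hL.2 hM.2 hL0.2 hM0.2,
          zpow_neg, ← inv_zpow, inv_neg_one, zpow_natCast, smul_eq_mul]
        simp only [List.cons.injEq, true_and, List.length_cons]
        split_ifs
        · rw [pow_succ]
          linear_combination (2 * 2 ^ L.length : ℂ) * h1
        · simp
      · rw [lt b a M L hM hab, if_neg]
        rintro ⟨⟩
        exact lt_irrefl _ hab

theorem form_schurQ_schurP (l l' : Multiset ℕ) (hl : l.Nodup) (hl' : l'.Nodup)
    (h : ∀ a ∈ l, 0 < a) (h' : ∀ a ∈ l', 0 < a) :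
    form (fun r => (r : ℂ) / 2) (schurQ l) (schurP l') = if l = l' then 1 else 0 := by
  rw [schurP, ← smul_eq_C_mul, map_smul, smul_eq_mul, schurQ_eq_vertexList l hl h,
    schurQ_eq_vertexList l' hl' h',
    form_vertexList_qLog _ _ (sort_pairwise_gt hl) (sort_pairwise_gt hl') (by simpa using h)
      (by simpa using h')]
  by_cases hll : l = l'
  · subst hll
    simp
  · rw [if_neg hll, if_neg, mul_zero]
    intro h1
    apply hll
    rw [← Multiset.sort_eq l (· ≥ ·), h1, Multiset.sort_eq]

theorem pderiv_vertexList {α : ℕ+ → ℂ} {r : ℕ+} (hr : α r = 0) (c : ℕ+ → ℂ) (L : List ℕ) :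
    pderiv r (vertexList α c L) = 0 := by
  induction L with
  | nil => simp [vertexList]
  | cons a L ih => simp [vertexList, pderiv_vertex, ih, hr]

theorem pderiv_schurQ {l : Multiset ℕ} (hl : l.Nodup) (h0 : ∀ a ∈ l, 0 < a) {r : ℕ+}
    (hr : Even (r : ℕ)) : pderiv r (schurQ l) = 0 := by
  rw [schurQ_eq_vertexList l hl h0]
  exact pderiv_vertexList (if_neg (Nat.not_odd_iff_even.2 hr)) _ _

theorem pderiv_schurP {l : Multiset ℕ} (hl : l.Nodup) (h0 : ∀ a ∈ l, 0 < a) {r : ℕ+}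
    (hr : Even (r : ℕ)) : pderiv r (schurP l) = 0 := by
  rw [schurP, pderiv_C_mul, pderiv_schurQ hl h0 hr, mul_zero]

theorem hasDegree_schurQ {l : Multiset ℕ} (hl : l.Nodup) (h0 : ∀ a ∈ l, 0 < a) :
    HasDegree (schurQ l) (l.sum : ℕ) := by
  rw [schurQ_eq_vertexList l hl h0, ← sum_sort l]
  exact hasDegree_vertexList _ _ _

theorem hasDegree_schurP {l : Multiset ℕ} (hl : l.Nodup) (h0 : ∀ a ∈ l, 0 < a) :
    HasDegree (schurP l) (l.sum : ℕ) :=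
  (hasDegree_schurQ hl h0).C_mul _

/-! ### The substitutions F(x²) and F(x, x) -/

theorem squared_X_mul (r : ℕ+) (F : Sym) : squared (X r * F) = X (2 * r) * squared F := by
  rw [map_mul, squared, aeval_X]

theorem doubled_X_mul (r : ℕ+) (F : Sym) :
    doubled (X r * F) = (2 : ℂ) • (X r * doubled F) := by
  rw [map_mul, doubled, aeval_X, smul_eq_C_mul, map_ofNat, mul_assoc]

theorem HasDegree.squared {F : Sym} {d : ℤ} (hF : HasDegree F d) :
    HasDegree (squared F) (2 * d) := by
  refine HasDegree.of_monomial (L := CompoundBasis.squared.toLinearMap) (f := fun d => 2 * d)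
    (fun m => ?_) hF
  refine monomial_induction (P := fun m F => HasDegree (CompoundBasis.squared F)
    (2 * Finsupp.weight degWeight m)) m ?_ ?_
  · simpa using isWeightedHomogeneous_one ℂ degWeight
  · intro r m h
    rw [squared_X_mul, map_add, Finsupp.weight_single, one_smul]
    convert h.X_mul (2 * r) using 1
    simp only [degWeight]
    push_cast
    ring

theorem HasDegree.doubled {F : Sym} {d : ℤ} (hF : HasDegree F d) : HasDegree (doubled F) d := by
  refine HasDegree.of_monomial (L := CompoundBasis.doubled.toLinearMap) (f := fun d => d)
    (fun m => ?_) hF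
  refine monomial_induction (P := fun m F => HasDegree (CompoundBasis.doubled F)
    (Finsupp.weight degWeight m)) m ?_ ?_
  · simpa using isWeightedHomogeneous_one ℂ degWeight
  · intro r m h
    rw [doubled_X_mul, map_add, Finsupp.weight_single, one_smul, smul_eq_C_mul]
    exact (h.X_mul r).C_mul _

theorem pderiv_squared_of_odd {r : ℕ+} (hr : Odd (r : ℕ)) (F : Sym) :
    pderiv r (squared F) = 0 := by
  induction F using sym_induction with
  | one => simp
  | add F G hF hG => rw [map_add, map_add, hF, hG, add_zero]
  | smul b F hF => rw [map_smul, Derivation.map_smul, hF, smul_zero]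
  | X_mul s F hF =>
    rw [squared_X_mul, pderiv_mul, hF, mul_zero, add_zero, pderiv_X_of_ne, zero_mul]
    rintro rfl
    rw [PNat.mul_coe] at hr
    exact Nat.not_even_iff_odd.2 hr (even_two_mul _)

theorem pderiv_squared_two_mul (r : ℕ+) (F : Sym) :
    pderiv (2 * r) (squared F) = squared (pderiv r F) := by
  induction F using sym_induction with
  | one => simp
  | add F G hF hG => simp only [map_add, hF, hG]
  | smul b F hF => simp only [map_smul, Derivation.map_smul, hF]
  | X_mul s F hF =>
    rw [squared_X_mul, pderiv_mul, hF, pderiv_mul, map_add, squared_X_mul]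
    by_cases hs : s = r
    · rw [hs, pderiv_X_self, pderiv_X_self, one_mul, one_mul]
    · rw [pderiv_X_of_ne hs, pderiv_X_of_ne fun h => hs (mul_left_cancel h), zero_mul, zero_mul,
        map_zero]

/-- The variable p_{2r} has weight 2r / 2 = r. -/
theorem form_squared (F G : Sym) : form (fun r => (r : ℂ) / 2) (squared F) (squared G) =
    form (fun r => (r : ℂ)) F G := by
  induction F using sym_induction generalizing G with
  | one =>
    rw [map_one, form_one_left, form_one_left]
    induction G using sym_induction with
    | one => simp
    | add F G hF hG => simp only [map_add, coeff_add, hF, hG]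
    | smul b F hF => simp only [map_smul, coeff_smul, hF]
    | X_mul r F hF => rw [squared_X_mul, coeff_zero_X_mul, coeff_zero_X_mul]
  | add F F' hF hF' => simp only [map_add, LinearMap.add_apply, hF, hF']
  | smul b F hF => simp only [map_smul, LinearMap.smul_apply, hF]
  | X_mul r F hF =>
    rw [squared_X_mul, form_X_mul, form_X_mul, pderiv_squared_two_mul, hF, PNat.mul_coe]
    push_cast
    simp

/-- The factor 2 in p_r ↦ 2 p_r compensates for the halved weight, so only the first argument is
substituted. -/
theorem form_doubled (F G : Sym) :
    form (fun r => (r : ℂ) / 2) (doubled F) G = form (fun r => (r : ℂ)) F G := by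
  induction F using sym_induction generalizing G with
  | one => rw [map_one, form_one_left, form_one_left]
  | add F F' hF hF' => simp only [map_add, LinearMap.add_apply, hF, hF']
  | smul b F hF => simp only [map_smul, LinearMap.smul_apply, hF]
  | X_mul r F hF =>
    rw [doubled_X_mul, map_smul, LinearMap.smul_apply, form_X_mul, form_X_mul, hF, smul_eq_mul]
    ring

theorem coeff_doubled (m : ℕ+ →₀ ℕ) (F : Sym) :
    coeff m (doubled F) * zeeW (fun r => (r : ℂ) / 2) m = coeff m F * zeeW (fun r => (r : ℂ)) m := by
  have h := form_doubled F (monomial m 1)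
  rw [form_comm, form_comm _ F, form_monomial, form_monomial, one_mul, one_mul] at h
  rw [mul_comm, h, mul_comm]

/-! ### Multiplicativity of the form over disjoint sets of variables -/

section Factorization

variable {s : Set ℕ+}

/-- The vanishing derivatives say that F uses only variables in s and G only variables outside s, so
(m, k) is the only splitting that can contribute. -/
theorem coeff_add_mul {F G : Sym} (hF : ∀ r ∉ s, pderiv r F = 0) (hG : ∀ r ∈ s, pderiv r G = 0)
    {m k : ℕ+ →₀ ℕ} (hm : ∀ r ∉ s, m r = 0) (hk : ∀ r ∈ s, k r = 0) :
    coeff (m + k) (F * G) = coeff m F * coeff k G := by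
  rw [coeff_mul, Finset.sum_eq_single (m, k)]
  · rintro ⟨m', k'⟩ h hne
    rw [Finset.HasAntidiagonal.mem_antidiagonal] at h
    by_contra h0
    have hm' : ∀ r ∉ s, m' r = 0 := fun r hr => by
      by_contra h1
      exact h0 (by rw [coeff_eq_zero_of_pderiv (hF r hr) h1, zero_mul])
    have hk' : ∀ r ∈ s, k' r = 0 := fun r hr => by
      by_contra h1
      exact h0 (by rw [coeff_eq_zero_of_pderiv (hG r hr) h1, mul_zero])
    apply hne
    have h2 : ∀ r, m' r + k' r = m r + k r := fun r => DFunLike.congr_fun h r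
    ext r
    · by_cases hr : r ∈ s
      · have := h2 r; rw [hk r hr, hk' r hr] at this; exact this
      · rw [hm r hr, hm' r hr]
    · by_cases hr : r ∈ s
      · rw [hk r hr, hk' r hr]
      · have := h2 r; rw [hm r hr, hm' r hr, zero_add, zero_add] at this; exact this
  · intro h
    rw [Finset.HasAntidiagonal.mem_antidiagonal] at h
    exact absurd rfl h

theorem zeeW_add (w : ℕ+ → ℂ) {m k : ℕ+ →₀ ℕ} (hm : ∀ r ∉ s, m r = 0) (hk : ∀ r ∈ s, k r = 0) :
    zeeW w (m + k) = zeeW w m * zeeW w k := by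
  refine Finsupp.prod_add_index_of_disjoint (Finset.disjoint_left.2 fun r h1 h2 => ?_) _
  rw [Finsupp.mem_support_iff] at h1 h2
  by_cases hr : r ∈ s
  · exact h2 (hk r hr)
  · exact h1 (hm r hr)

/-- The form is multiplicative for a partition of the set of variables into two sets. -/
theorem form_mul_mul (w : ℕ+ → ℂ) {F F' G G' : Sym} (hF : ∀ r ∉ s, pderiv r F = 0)
    (hF' : ∀ r ∉ s, pderiv r F' = 0) (hG : ∀ r ∈ s, pderiv r G = 0)
    (hG' : ∀ r ∈ s, pderiv r G' = 0) :
    form w (F * G) (F' * G') = form w F F' * form w G G' := by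
  have h : F * G = ∑ m ∈ F.support, ∑ k ∈ G.support,
      monomial m (coeff m F) * monomial k (coeff k G) := by
    rw [← Finset.sum_mul_sum, ← F.as_sum, ← G.as_sum]
  rw [h, form_eq_sum w F F' _ subset_rfl, form_eq_sum w G G' _ subset_rfl, Finset.sum_mul_sum,
    map_sum, LinearMap.sum_apply]
  refine Finset.sum_congr rfl fun m hm => ?_
  rw [map_sum, LinearMap.sum_apply]
  refine Finset.sum_congr rfl fun k hk => ?_
  have hm' : ∀ r ∉ s, m r = 0 := fun r hr => by
    by_contra h1
    exact mem_support_iff.1 hm (coeff_eq_zero_of_pderiv (hF r hr) h1)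
  have hk' : ∀ r ∈ s, k r = 0 := fun r hr => by
    by_contra h1
    exact mem_support_iff.1 hk (coeff_eq_zero_of_pderiv (hG r hr) h1)
  rw [monomial_mul, form_monomial, coeff_add_mul hF' hG' hm' hk', zeeW_add w hm' hk']
  ring

end Factorization

/-! ### Real coefficients: the sesquilinear form agrees with the bilinear one -/

section Reality

theorem map_conj_smul (a : ℂ) (F : Sym) :
    map (starRingEnd ℂ) (a • F) = conj a • map (starRingEnd ℂ) F := by
  rw [smul_eq_C_mul, map_mul, map_C, smul_eq_C_mul]

theorem map_conj_expPart {α : ℕ+ → ℂ} (hα : ∀ r, conj (α r) = α r) (n : ℤ) :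
    map (starRingEnd ℂ) (expPart α n) = expPart α n := by
  ext m
  rw [coeff_map, coeff_expPart, apply_ite (starRingEnd ℂ), map_zero, expCoeff, Finsupp.prod,
    map_prod]
  simp [hα]

theorem map_conj_vertex {α c : ℕ+ → ℂ} (hα : ∀ r, conj (α r) = α r)
    (hc : ∀ r, conj (c r) = c r) (m : ℤ) (F : Sym) :
    map (starRingEnd ℂ) (vertex α c m F) = vertex α c m (map (starRingEnd ℂ) F) := by
  induction F using sym_induction generalizing m with
  | one => rw [vertex_one, map_conj_expPart hα, map_one (map (starRingEnd ℂ)), vertex_one]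
  | add F G hF hG => simp only [map_add, hF, hG]
  | smul b F hF => rw [map_smul, map_conj_smul, map_conj_smul, hF, map_smul]
  | X_mul r F hF =>
    rw [map_mul (map (starRingEnd ℂ)), map_X, vertex_X_mul, vertex_X_mul, map_add,
      map_mul (map (starRingEnd ℂ)), map_X, hF, map_mul (map (starRingEnd ℂ)), map_C, hc, hF]

theorem map_conj_vertexList {α c : ℕ+ → ℂ} (hα : ∀ r, conj (α r) = α r)
    (hc : ∀ r, conj (c r) = c r) (L : List ℕ) :
    map (starRingEnd ℂ) (vertexList α c L) = vertexList α c L := by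
  induction L with
  | nil => rw [vertexList, map_one]
  | cons a L ih => rw [vertexList, map_conj_vertex hα hc, ih]

theorem map_conj_schur (ν : Multiset ℕ) : map (starRingEnd ℂ) (schur ν) = schur ν := by
  rw [schur_eq_vertexList]
  exact map_conj_vertexList (fun r => by simp [hLog]) (fun r => by simp) _

theorem map_conj_schurP {l : Multiset ℕ} (hl : l.Nodup) (h0 : ∀ a ∈ l, 0 < a) :
    map (starRingEnd ℂ) (schurP l) = schurP l := by
  rw [schurP, schurQ_eq_vertexList l hl h0, map_mul, map_C, map_conj_vertexList]
  · simp [Complex.conj_ofNat]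
  · intro r
    rw [qLog]
    split_ifs <;> simp [Complex.conj_ofNat]
  · intro r
    rw [Pi.neg_apply, oddInd]
    split_ifs <;> simp

theorem map_conj_squared (F : Sym) :
    map (starRingEnd ℂ) (squared F) = squared (map (starRingEnd ℂ) F) := by
  induction F using sym_induction with
  | one => simp
  | add F G hF hG => simp only [map_add, hF, hG]
  | smul b F hF => rw [map_smul, map_conj_smul, map_conj_smul, hF, map_smul]
  | X_mul r F hF => rw [squared_X_mul, map_mul, map_X, hF, map_mul, map_X, squared_X_mul]

theorem inner₀_eq_form (F : Sym) {G : Sym} (hG : map (starRingEnd ℂ) G = G) :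
    inner₀ F G = form (fun r => (r : ℂ)) F G := by
  rw [form_eq_sum _ F G _ subset_rfl, inner₀]
  refine Finset.sum_congr rfl fun m _ => ?_
  have h : conj (coeff m G) = coeff m G := by
    conv_rhs => rw [← hG, coeff_map]
  rw [h, mul_right_comm]
  rfl

end Reality

/-! ### Recovering λ from λ^r and λ^d -/

section Parts

variable {n : ℕ} (l : n.Partition)

theorem count_rPart (i : ℕ) : (rPart l).count i = l.parts.count i % 2 := by
  rw [rPart, Finsupp.count_toMultiset, Finsupp.mapRange_apply, Multiset.toFinsupp_apply]

theorem count_dPart (i : ℕ) : (dPart l).count i = l.parts.count i / 2 := by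
  rw [dPart, Finsupp.count_toMultiset, Finsupp.mapRange_apply, Multiset.toFinsupp_apply]

theorem rPart_nodup : (rPart l).Nodup := by
  rw [Multiset.nodup_iff_count_le_one]
  intro i
  rw [count_rPart]
  omega

theorem pos_of_mem_rPart : ∀ i ∈ rPart l, 0 < i := by
  intro i hi
  refine l.parts_pos (Multiset.count_pos.1 ?_)
  have := Multiset.count_pos.2 hi
  rw [count_rPart] at this
  omega

theorem pos_of_mem_dPart : ∀ i ∈ dPart l, 0 < i := by
  intro i hi
  refine l.parts_pos (Multiset.count_pos.1 ?_)
  have := Multiset.count_pos.2 hi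
  rw [count_dPart] at this
  omega

theorem rPart_add_dPart : rPart l + 2 • dPart l = l.parts := by
  ext i
  rw [Multiset.count_add, Multiset.count_nsmul, count_rPart, count_dPart]
  omega

theorem sum_rPart_add : (((rPart l).sum : ℕ) : ℤ) + 2 * ((dPart l).sum : ℕ) = n := by
  have h := congrArg Multiset.sum (rPart_add_dPart l)
  rw [Multiset.sum_add, Multiset.sum_nsmul, l.parts_sum, smul_eq_mul] at h
  exact_mod_cast h

end Parts

/-! ### The dual family and coefficient matrices in fixed degree -/

/-- The dual `P_{λ^r}(x) S_{λ^d}(x²)` of the compound function. -/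
def dualW {n : ℕ} (l : n.Partition) : Sym := schurP (rPart l) * squared (schur (dPart l))

theorem hasDegree_W {n : ℕ} (l : n.Partition) : HasDegree (W l) n := by
  rw [← sum_rPart_add l]
  exact (hasDegree_schurQ (rPart_nodup l) (pos_of_mem_rPart l)).mul (hasDegree_schur _).squared

theorem hasDegree_dualW {n : ℕ} (l : n.Partition) : HasDegree (dualW l) n := by
  rw [← sum_rPart_add l]
  exact (hasDegree_schurP (rPart_nodup l) (pos_of_mem_rPart l)).mul (hasDegree_schur _).squared

theorem form_W_dualW {n : ℕ} (l m : n.Partition) :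
    form (fun r => (r : ℂ) / 2) (W l) (dualW m) = if l = m then 1 else 0 := by
  rw [W, dualW, form_mul_mul (s := {r : ℕ+ | Odd (r : ℕ)})]
  · rw [form_schurQ_schurP _ _ (rPart_nodup l) (rPart_nodup m) (pos_of_mem_rPart l)
      (pos_of_mem_rPart m), form_squared,
      form_schur _ _ (pos_of_mem_dPart l) (pos_of_mem_dPart m)]
    by_cases h : l = m
    · subst h; simp
    · rw [if_neg h]
      by_cases h1 : rPart l = rPart m
      · rw [if_pos h1, one_mul, if_neg fun h2 => h ?_]
        ext1
        rw [← rPart_add_dPart l, ← rPart_add_dPart m, h1, h2]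
      · rw [if_neg h1, zero_mul]
  · exact fun r hr => pderiv_schurQ (rPart_nodup l) (pos_of_mem_rPart l) (Nat.not_odd_iff_even.1 hr)
  · exact fun r hr => pderiv_schurP (rPart_nodup m) (pos_of_mem_rPart m) (Nat.not_odd_iff_even.1 hr)
  · exact fun r hr => pderiv_squared_of_odd hr _
  · exact fun r hr => pderiv_squared_of_odd hr _

theorem form_dualW_dualW {n : ℕ} (l m : n.Partition) :
    form (fun r => (r : ℂ)) (dualW l) (dualW m) =
      inner₀ (schurP (rPart l)) (schurP (rPart m)) *
        inner₀ (squared (schur (dPart l))) (squared (schur (dPart m))) := by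
  rw [dualW, dualW, form_mul_mul (s := {r : ℕ+ | Odd (r : ℕ)}),
    inner₀_eq_form _ (map_conj_schurP (rPart_nodup m) (pos_of_mem_rPart m)),
    inner₀_eq_form _ (by rw [map_conj_squared, map_conj_schur])]
  · exact fun r hr => pderiv_schurP (rPart_nodup l) (pos_of_mem_rPart l) (Nat.not_odd_iff_even.1 hr)
  · exact fun r hr => pderiv_schurP (rPart_nodup m) (pos_of_mem_rPart m) (Nat.not_odd_iff_even.1 hr)
  · exact fun r hr => pderiv_squared_of_odd hr _
  · exact fun r hr => pderiv_squared_of_odd hr _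

theorem form_eq_sum_partitions (w : ℕ+ → ℂ) {n : ℕ} {F : Sym} (hF : HasDegree F n) (G : Sym) :
    form w F G =
      ∑ ρ : n.Partition, coeff (mults ρ) F * zeeW w (mults ρ) * coeff (mults ρ) G := by
  classical
  rw [form_eq_sum w F G (Finset.univ.image (mults : n.Partition → ℕ+ →₀ ℕ)),
    Finset.sum_image fun ρ _ σ _ h => mults_injective n h]
  intro m hm
  obtain ⟨ρ, rfl⟩ := exists_mults_eq (hF (mem_support_iff.1 hm))
  exact Finset.mem_image_of_mem _ (Finset.mem_univ ρ)

theorem HasDegree.eq_of_coeff {n : ℕ} {F G : Sym} (hF : HasDegree F n) (hG : HasDegree G n)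
    (h : ∀ ρ : n.Partition, coeff (mults ρ) F = coeff (mults ρ) G) : F = G := by
  ext m
  by_cases hm : Finsupp.weight degWeight m = n
  · obtain ⟨ρ, rfl⟩ := exists_mults_eq hm
    exact h ρ
  · rw [hF.coeff_eq_zero m hm, hG.coeff_eq_zero m hm]

/-- The matrix of the coefficients in the basis `p_ρ` of a family of elements of degree `n`. -/
def coeffMatrix {n : ℕ} (F : n.Partition → Sym) : Matrix n.Partition n.Partition ℂ :=
  Matrix.of fun l ρ => coeff (mults ρ) (F l)

theorem coeffMatrix_mul_diagonal_mul (w : ℕ+ → ℂ) {n : ℕ} {F : n.Partition → Sym}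
    (hF : ∀ l, HasDegree (F l) n) (G : n.Partition → Sym) :
    coeffMatrix F * Matrix.diagonal (fun ρ => zeeW w (mults ρ)) * (coeffMatrix G).transpose =
      Matrix.of fun l m => form w (F l) (G m) := by
  ext l m
  rw [Matrix.mul_apply, Matrix.of_apply, form_eq_sum_partitions w (hF l)]
  simp [coeffMatrix, Matrix.mul_diagonal]

theorem isTransitionMatrix_iff {n : ℕ} (A : Matrix n.Partition n.Partition ℂ) :
    IsTransitionMatrix n A ↔
      coeffMatrix (fun l : n.Partition => doubled (schur l.parts)) = A * coeffMatrix W := by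
  have hcoeff : ∀ l ρ : n.Partition, coeff (mults ρ) (∑ m : n.Partition, C (A l m) * W m) =
      (A * coeffMatrix (W (n := n))) l ρ := by
    intro l ρ
    simp [Matrix.mul_apply, coeff_sum, coeff_C_mul, coeffMatrix]
  constructor
  · intro h
    ext l ρ
    rw [← hcoeff, ← h l]
    rfl
  · intro h l
    refine HasDegree.eq_of_coeff (n := n) ?_ ?_ fun ρ => ?_
    · have := hasDegree_schur l.parts
      rw [l.parts_sum] at this
      exact this.doubled
    · exact IsWeightedHomogeneous.sum _ _ _ fun m _ => (hasDegree_W m).C_mul _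
    · rw [hcoeff, ← h]
      rfl

end CompoundBasis

end
-- The transition matrix
theorem proposition4p9 (n : ℕ) :
    (∃! A : Matrix n.Partition n.Partition ℂ, CompoundBasis.IsTransitionMatrix n A) ∧
    ∀ A : Matrix n.Partition n.Partition ℂ, CompoundBasis.IsTransitionMatrix n A →
      A.transpose * A = Matrix.of fun l m : n.Partition =>
        CompoundBasis.inner₀ (CompoundBasis.schurP (CompoundBasis.rPart l))
            (CompoundBasis.schurP (CompoundBasis.rPart m)) *
          CompoundBasis.inner₀
            (CompoundBasis.squared (CompoundBasis.schur (CompoundBasis.dPart l)))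
            (CompoundBasis.squared (CompoundBasis.schur (CompoundBasis.dPart m))) := by
  classical
  set S := CompoundBasis.coeffMatrix fun l : n.Partition => CompoundBasis.schur l.parts with hS
  set D := CompoundBasis.coeffMatrix fun l : n.Partition =>
    CompoundBasis.doubled (CompoundBasis.schur l.parts) with hD
  set M := CompoundBasis.coeffMatrix (CompoundBasis.W (n := n)) with hM
  set N := CompoundBasis.coeffMatrix (CompoundBasis.dualW (n := n)) with hN
  set Z₀ : Matrix n.Partition n.Partition ℂ := Matrix.diagonal fun ρ =>
    CompoundBasis.zeeW (fun r => (r : ℂ)) (CompoundBasis.mults ρ) with hZ₀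
  set Z₁ : Matrix n.Partition n.Partition ℂ := Matrix.diagonal fun ρ =>
    CompoundBasis.zeeW (fun r => (r : ℂ) / 2) (CompoundBasis.mults ρ) with hZ₁
  have hSdeg : ∀ l : n.Partition, CompoundBasis.HasDegree (CompoundBasis.schur l.parts) n := by
    intro l
    have := CompoundBasis.hasDegree_schur l.parts
    rwa [l.parts_sum] at this
  have hSS : S * (Z₀ * S.transpose) = 1 := by
    rw [← mul_assoc, hS, hZ₀, CompoundBasis.coeffMatrix_mul_diagonal_mul _ hSdeg]
    ext l m
    rw [Matrix.of_apply, CompoundBasis.form_schur _ _ (fun _ h => l.parts_pos h)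
      (fun _ h => m.parts_pos h), Matrix.one_apply]
    simp only [Nat.Partition.ext_iff]
  have hMN : M * (Z₁ * N.transpose) = 1 := by
    rw [← mul_assoc, hM, hZ₁, hN,
      CompoundBasis.coeffMatrix_mul_diagonal_mul _ CompoundBasis.hasDegree_W]
    ext l m
    rw [Matrix.of_apply, CompoundBasis.form_W_dualW, Matrix.one_apply]
  have hDS : D * Z₁ = S * Z₀ := by
    ext l ρ
    rw [hD, hS, hZ₁, hZ₀, Matrix.mul_diagonal, Matrix.mul_diagonal]
    exact CompoundBasis.coeff_doubled _ _
  have hA : ∀ A, CompoundBasis.IsTransitionMatrix n A ↔ A = S * Z₀ * N.transpose := by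
    intro A
    rw [CompoundBasis.isTransitionMatrix_iff, ← hD, ← hM, ← hDS, mul_assoc]
    constructor
    · intro h
      rw [h, mul_assoc, hMN, mul_one]
    · rintro rfl
      -- A one-sided inverse of a finite square matrix is two-sided; this yields existence without a
      -- separate argument that the W_μ span.
      rw [mul_assoc, mul_eq_one_comm.1 hMN, mul_one]
  refine ⟨⟨_, (hA _).2 rfl, fun A h => (hA A).1 h⟩, fun A h => ?_⟩
  rw [(hA A).1 h]
  calc (S * Z₀ * N.transpose).transpose * (S * Z₀ * N.transpose)
      = N * (Z₀ * S.transpose * S) * (Z₀ * N.transpose) := by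
        simp only [Matrix.transpose_mul, Matrix.transpose_transpose, hZ₀,
          Matrix.diagonal_transpose, mul_assoc]
    -- Completeness of the orthonormal Schur functions, again by reversing the order of a matrix
    -- inverse.
    _ = N * Z₀ * N.transpose := by rw [mul_eq_one_comm.1 hSS, mul_one, mul_assoc]
    _ = _ := by
        rw [hN, hZ₀, CompoundBasis.coeffMatrix_mul_diagonal_mul _ CompoundBasis.hasDegree_dualW]
        ext l m
        exact CompoundBasis.form_dualW_dualW l m
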